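/- A $C^\infty$-ring is a set $A$ on which every smooth function $f\colon\mathbb R^n\to\mathbb R$ ($n\ge 0$) acts as an $n$-ary operation $A^n\to A$, compatibly with projections and composition. It has an underlying commutative ring, and quotients by ideals of that ring are again $C^\infty$-rings. A $C^\infty$-scheme is an object of the opposite of the category of $C^\infty$-rings; write $C^\infty(X)$ for the $C^\infty$-ring of $X$, and $\underline X=\mathrm{Hom}(-,X)$ for the presheaf on $C^\infty$-schemes represented by $X$. For an ideal $I$ of a $C^\infty$-ring $A$ let $\sqrt[\mathrm{nil}]{I}$ be its nilradical, and let $\sqrt[\infty]{I}=\{f\in A : (A/I)\{f^{-1}\}\cong 0\}$, where $\{f^{-1}\}$ means inverting $f$ in the category of $C^\infty$-rings. For a closed embedding $X'\hookrightarrow X$ of $C^\infty$-schemes given by a surjection $\varphi\colon A=C^\infty(X)\to C^\infty(X')$ put $$\mathcal N^{\mathrm{nil}}=\{I\le A : \sqrt[\mathrm{nil}]{I}=\sqrt[\mathrm{nil}]{\ker\varphi}\},\qquad \mathcal N^{\infty}=\{I\le A : \sqrt[\infty]{I}=\sqrt[\infty]{\ker\varphi}\},$$ $$\mathfrak m^{\mathrm{nil}}=\bigcap_{I\in\mathcal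 N^{\mathrm{nil}}}I,\qquad \mathfrak m^{\infty}=\{a\in A : \exists\, b\in A,\ ab=0,\ \varphi(b)\text{ is invertible}\}.$$ For $\kappa\in\{\mathrm{nil},\infty\}$ equip $A/\mathfrak m^{\kappa}$ with the linear topology generated by the cosets of the images of the ideals in $\mathcal N^{\kappa}$. The pro-nilpotent neighbourhood ($\kappa=\mathrm{nil}$), respectively the $\infty$-nilpotent neighbourhood ($\kappa=\infty$), of $X'$ in $X$ is the presheaf $$N^{\kappa}_{X}(X')\colon\ T\longmapsto \mathrm{Hom}_{\mathrm{cont}}\bigl(A/\mathfrak m^{\kappa},\,C^\infty(T)\bigr)$$ of continuous morphisms of $C^\infty$-rings, $C^\infty(T)$ being discrete. It comes with the canonical morphism $N^{\kappa}_{X}(X')\to\underline X$ given by composition with $A\to A/\mathfrak m^\kappa$. The pair groupoid of $X$ is $(\underline X,\underline X\times\underline X)$, with source and target the two projections, identities given by the diagonal, and composition $((x,y),(y,z))\mapsto(x,z)$. Its nerve is the simplicial presheaf $\underline X^{\bullet}=\{\underline X^{k+1}\}_{k\ge 0}$ with all projections and diagonals as structure morphisms. Products of $C^\infty$-schemes are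 taken in the category of $C^\infty$-schemes, and $X\hookrightarrow X^{k+1}$ denotes the main diagonal. **Proposition.** Let $X$ be any $C^\infty$-scheme and $\kappa\in\{\mathrm{nil},\infty\}$. 1. The morphism $N^{\kappa}_{X\times X}(X)\to\underline X\times\underline X$ is a monomorphism, and it makes $(\underline X, N^{\kappa}_{X\times X}(X))$ a sub-groupoid of the pair groupoid: it is stable under restriction, contains all identities, and is closed under inverses and composition. 2. The simplicial structure morphisms of $\underline X^{\bullet}$ restrict to the neighbourhoods of the main diagonals, so that these form a simplicial presheaf $N^{\kappa}_{X^\bullet}(X)=\{N^{\kappa}_{X^{k+1}}(X)\}_{k\ge 0}$ over $\underline X^{\bullet}$. The nerve of the sub-groupoid in 1 is isomorphic to $N^{\kappa}_{X^\bullet}(X)$ as a simplicial presheaf over $\underline X^{\bullet}$, the nerve of the pair groupoid. -/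

import Mathlib

open CategoryTheory CategoryTheory.Limits Opposite
open scoped ContDiff

universe u v w

/-! ## Smooth functions and C^∞-rings -/

/-- Smooth functions `ℝⁿ → ℝ`. -/
@[ext]
structure SmoothFn (n : ℕ) where
  toFun : (Fin n → ℝ) → ℝ
  smooth : ContDiff ℝ ∞ toFun

namespace SmoothFn

instance (n : ℕ) : CoeFun (SmoothFn n) (fun _ => (Fin n → ℝ) → ℝ) := ⟨SmoothFn.toFun⟩

/-- The `i`-th coordinate function. -/
def proj {n : ℕ} (i : Fin n) : SmoothFn n := ⟨fun x => x i, by fun_prop⟩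

/-- The composite `g ∘ (f₁, …, fₘ)`. -/
def comp {m n : ℕ} (g : SmoothFn m) (f : Fin m → SmoothFn n) : SmoothFn n :=
  ⟨fun x => g (fun j => f j x), g.smooth.comp (contDiff_pi.2 fun j => (f j).smooth)⟩

/-- The constant function. -/
def const (n : ℕ) (c : ℝ) : SmoothFn n := ⟨fun _ => c, contDiff_const⟩

/-- Addition `ℝ² → ℝ`. -/
def addFn : SmoothFn 2 := ⟨fun x => x 0 + x 1, by fun_prop⟩

/-- Multiplication `ℝ² → ℝ`. -/
def mulFn : SmoothFn 2 := ⟨fun x => x 0 * x 1, by fun_prop⟩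

/-- Negation `ℝ → ℝ`. -/
def negFn : SmoothFn 1 := ⟨fun x => - x 0, by fun_prop⟩

end SmoothFn

/-- A C^∞-ring: a set on which every smooth function `ℝⁿ → ℝ` acts as an `n`-ary operation,
compatibly with projections and composition; equivalently a product-preserving functor from the
category of the spaces `ℝⁿ` and smooth maps to sets. -/
class CInfRing (A : Type u) where
  op : ∀ {n : ℕ}, SmoothFn n → (Fin n → A) → A
  op_proj : ∀ {n : ℕ} (i : Fin n) (a : Fin n → A), op (SmoothFn.proj i) a = a i
  op_comp : ∀ {m n : ℕ} (g : SmoothFn m) (f : Fin m → SmoothFn n) (a : Fin n → A),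
    op (g.comp f) a = op g (fun j => op (f j) a)

/-- The free C^∞-ring `C^∞(ℝⁿ)`. -/
instance (n : ℕ) : CInfRing (SmoothFn n) where
  op g f := g.comp f
  op_proj _ _ := rfl
  op_comp _ _ _ := rfl

namespace CInfRing

variable {A : Type u} [CInfRing A]

theorem op_vec_zero (f : SmoothFn 0) {n : ℕ} (v : Fin n → A) (w : Fin 0 → A) :
    op f w = op (f.comp ![]) v := by
  rw [op_comp]; congr 1; exact Subsingleton.elim _ _

theorem op_vec_one (f : SmoothFn 1) {n : ℕ} (v : Fin n → A) (g : SmoothFn n) :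
    op f ![op g v] = op (f.comp ![g]) v := by
  rw [op_comp]; congr 1; funext i; fin_cases i; rfl

theorem op_vec_two (f : SmoothFn 2) {n : ℕ} (v : Fin n → A) (g h : SmoothFn n) :
    op f ![op g v, op h v] = op (f.comp ![g, h]) v := by
  rw [op_comp]; congr 1; funext i; fin_cases i <;> rfl

/-- The commutative ring underlying a C^∞-ring: its operations are those given by addition,
multiplication, negation and the constants `0`, `1`. -/
instance toCommRing : CommRing A := by
  have key3 : ∀ (F G : SmoothFn 3) (v : Fin 3 → A), (∀ x, F x = G x) → op F v = op G v := by
    intro F G a h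
    have : F = G := by ext x; exact h x
    rw [this]
  have e30 : ∀ a b c : A, a = op (SmoothFn.proj 0) ![a, b, c] :=
    fun a b c => (op_proj 0 ![a, b, c]).symm
  have e31 : ∀ a b c : A, b = op (SmoothFn.proj 1) ![a, b, c] :=
    fun a b c => (op_proj 1 ![a, b, c]).symm
  have e32 : ∀ a b c : A, c = op (SmoothFn.proj 2) ![a, b, c] :=
    fun a b c => (op_proj 2 ![a, b, c]).symm
  have addc : ∀ a b : A, op SmoothFn.addFn ![a, b] = op SmoothFn.addFn ![b, a] := by
    intro a b
    have h0 := e30 a b a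
    have h1 := e31 a b a
    generalize ![a, b, a] = v at h0 h1
    rw [h0, h1, op_vec_two, op_vec_two]
    exact key3 _ _ _ fun x => by simp [SmoothFn.addFn, SmoothFn.comp, SmoothFn.proj, add_comm]
  have mulc : ∀ a b : A, op SmoothFn.mulFn ![a, b] = op SmoothFn.mulFn ![b, a] := by
    intro a b
    have h0 := e30 a b a
    have h1 := e31 a b a
    generalize ![a, b, a] = v at h0 h1
    rw [h0, h1, op_vec_two, op_vec_two]
    exact key3 _ _ _ fun x => by simp [SmoothFn.mulFn, SmoothFn.comp, SmoothFn.proj, mul_comm]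
  have zadd : ∀ a : A, op SmoothFn.addFn ![op (SmoothFn.const 0 0) ![], a] = a := by
    intro a
    have h0 := e30 a a a
    generalize ![a, a, a] = v at h0
    rw [h0, op_vec_zero _ v, op_vec_two]
    exact key3 _ _ _ fun x => by simp [SmoothFn.addFn, SmoothFn.comp, SmoothFn.proj, SmoothFn.const]
  have omul : ∀ a : A, op SmoothFn.mulFn ![op (SmoothFn.const 0 1) ![], a] = a := by
    intro a
    have h0 := e30 a a a
    generalize ![a, a, a] = v at h0
    rw [h0, op_vec_zero _ v, op_vec_two]
    exact key3 _ _ _ fun x => by simp [SmoothFn.mulFn, SmoothFn.comp, SmoothFn.proj, SmoothFn.const]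
  have zmul : ∀ a : A, op SmoothFn.mulFn ![op (SmoothFn.const 0 0) ![], a] =
      op (SmoothFn.const 0 0) ![] := by
    intro a
    have h0 := e30 a a a
    generalize ![a, a, a] = v at h0
    rw [h0, op_vec_zero _ v, op_vec_two]
    exact key3 _ _ _ fun x => by simp [SmoothFn.mulFn, SmoothFn.comp, SmoothFn.proj, SmoothFn.const]
  have nadd : ∀ a : A, op SmoothFn.addFn ![op SmoothFn.negFn ![a], a] =
      op (SmoothFn.const 0 0) ![] := by
    intro a
    have h0 := e30 a a a
    generalize ![a, a, a] = v at h0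
    rw [h0, op_vec_zero _ v, op_vec_one, op_vec_two]
    exact key3 _ _ _ fun x => by
      simp [SmoothFn.addFn, SmoothFn.negFn, SmoothFn.comp, SmoothFn.proj, SmoothFn.const]
  have dist : ∀ a b c : A, op SmoothFn.mulFn ![a, op SmoothFn.addFn ![b, c]] =
      op SmoothFn.addFn ![op SmoothFn.mulFn ![a, b], op SmoothFn.mulFn ![a, c]] := by
    intro a b c
    have h0 := e30 a b c
    have h1 := e31 a b c
    have h2 := e32 a b c
    generalize ![a, b, c] = v at h0 h1 h2
    rw [h0, h1, h2]
    simp only [op_vec_two]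
    exact key3 _ _ _ fun x => by
      simp [SmoothFn.mulFn, SmoothFn.addFn, SmoothFn.comp, SmoothFn.proj, mul_add]
  exact
  { zero := op (SmoothFn.const 0 0) ![]
    one := op (SmoothFn.const 0 1) ![]
    add := fun a b => op SmoothFn.addFn ![a, b]
    mul := fun a b => op SmoothFn.mulFn ![a, b]
    neg := fun a => op SmoothFn.negFn ![a]
    nsmul := @nsmulRec A ⟨op (SmoothFn.const 0 0) ![]⟩ ⟨fun a b => op SmoothFn.addFn ![a, b]⟩
    zsmul := @zsmulRec A ⟨op (SmoothFn.const 0 0) ![]⟩ ⟨fun a b => op SmoothFn.addFn ![a, b]⟩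
      ⟨fun a => op SmoothFn.negFn ![a]⟩
      (@nsmulRec A ⟨op (SmoothFn.const 0 0) ![]⟩ ⟨fun a b => op SmoothFn.addFn ![a, b]⟩)
    zero_add := zadd
    add_zero := fun a => (addc _ _).trans (zadd a)
    add_comm := addc
    mul_comm := mulc
    one_mul := omul
    mul_one := fun a => (mulc _ _).trans (omul a)
    zero_mul := zmul
    mul_zero := fun a => (mulc _ _).trans (zmul a)
    neg_add_cancel := nadd
    left_distrib := dist
    right_distrib := fun a b c => (mulc _ _).trans ((dist c a b).trans (by
      show op _ ![_, _] = op _ ![_, _]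
      rw [mulc c a, mulc c b]; rfl))
    add_assoc := by
      intro a b c
      show op SmoothFn.addFn ![op SmoothFn.addFn ![a, b], c] =
        op SmoothFn.addFn ![a, op SmoothFn.addFn ![b, c]]
      have h0 := e30 a b c
      have h1 := e31 a b c
      have h2 := e32 a b c
      generalize ![a, b, c] = v at h0 h1 h2
      rw [h0, h1, h2]
      simp only [op_vec_two]
      exact key3 _ _ _ fun x => by
        simp [SmoothFn.addFn, SmoothFn.comp, SmoothFn.proj, add_assoc]
    mul_assoc := by
      intro a b c
      show op SmoothFn.mulFn ![op SmoothFn.mulFn ![a, b], c] =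
        op SmoothFn.mulFn ![a, op SmoothFn.mulFn ![b, c]]
      have h0 := e30 a b c
      have h1 := e31 a b c
      have h2 := e32 a b c
      generalize ![a, b, c] = v at h0 h1 h2
      rw [h0, h1, h2]
      simp only [op_vec_two]
      exact key3 _ _ _ fun x => by
        simp [SmoothFn.mulFn, SmoothFn.comp, SmoothFn.proj, mul_assoc] }

theorem add_def (a b : A) : a + b = op SmoothFn.addFn ![a, b] := rfl
theorem mul_def (a b : A) : a * b = op SmoothFn.mulFn ![a, b] := rfl
theorem neg_def (a : A) : -a = op SmoothFn.negFn ![a] := rfl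
theorem zero_def : (0 : A) = op (SmoothFn.const 0 0) ![] := rfl
theorem one_def : (1 : A) = op (SmoothFn.const 0 1) ![] := rfl

end CInfRing

/-- Morphisms of C^∞-rings: maps commuting with all smooth operations. -/
@[ext]
structure CInfHom (A : Type u) (B : Type v) [CInfRing A] [CInfRing B] where
  toFun : A → B
  map_op : ∀ {n : ℕ} (f : SmoothFn n) (a : Fin n → A),
    toFun (CInfRing.op f a) = CInfRing.op f (fun i => toFun (a i))

namespace CInfHom

variable {A : Type u} {B : Type v} {C : Type w} [CInfRing A] [CInfRing B] [CInfRing C]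

instance : CoeFun (CInfHom A B) (fun _ => A → B) := ⟨CInfHom.toFun⟩

/-- The identity. -/
def id (A : Type u) [CInfRing A] : CInfHom A A := ⟨fun a => a, fun _ _ => rfl⟩

/-- Composition (first `f`, then `g`). -/
def comp (g : CInfHom B C) (f : CInfHom A B) : CInfHom A C :=
  ⟨fun a => g (f a), fun h a => by rw [f.map_op, g.map_op]⟩

/-- A morphism of C^∞-rings is a morphism of the underlying rings. -/
def toRingHom (φ : CInfHom A B) : A →+* B where
  toFun := φ
  map_zero' := by
    rw [CInfRing.zero_def, CInfRing.zero_def, φ.map_op]; congr 1; exact Subsingleton.elim _ _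
  map_one' := by
    rw [CInfRing.one_def, CInfRing.one_def, φ.map_op]; congr 1; exact Subsingleton.elim _ _
  map_add' a b := by
    rw [CInfRing.add_def, CInfRing.add_def, φ.map_op]; congr 1; funext i; fin_cases i <;> rfl
  map_mul' a b := by
    rw [CInfRing.mul_def, CInfRing.mul_def, φ.map_op]; congr 1; funext i; fin_cases i <;> rfl

/-- The kernel ideal. -/
def ker (φ : CInfHom A B) : Ideal A := RingHom.ker φ.toRingHom

end CInfHom

/-! ## Quotients by ideals -/

theorem contDiff_nat_parametric_integral {E : Type} [NormedAddCommGroup E] [NormedSpace ℝ E]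
    [FiniteDimensional ℝ E] (n : ℕ) : ∀ {G : Type} [NormedAddCommGroup G] [NormedSpace ℝ G]
    [CompleteSpace G] (F : E × ℝ → G), ContDiff ℝ ∞ F →
    ContDiff ℝ n (fun x => ∫ t in (0 : ℝ)..1, F (x, t)) := by
  have hder : ∀ {G : Type} [NormedAddCommGroup G] [NormedSpace ℝ G]
      [CompleteSpace G] (F : E × ℝ → G), ContDiff ℝ ∞ F → ∀ x, HasFDerivAt
      (fun x => ∫ t in (0 : ℝ)..1, F (x, t))
      (∫ t in (0 : ℝ)..1, (fderiv ℝ F (x, t)).comp (ContinuousLinearMap.inl ℝ E ℝ)) x := by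
    intro G _ _ _ F hF x
    have hF' : Continuous (fun p : E × ℝ =>
        (fderiv ℝ F p).comp (ContinuousLinearMap.inl ℝ E ℝ)) :=
      (hF.continuous_fderiv (by simp)).clm_comp continuous_const
    have hK : IsCompact (Metric.closedBall x 1 ×ˢ Set.Icc (0 : ℝ) 1) :=
      (isCompact_closedBall x 1).prod isCompact_Icc
    obtain ⟨M, hM⟩ := hK.exists_bound_of_continuousOn hF'.continuousOn
    refine intervalIntegral.hasFDerivAt_integral_of_dominated_of_fderiv_le
      (F' := fun y t => (fderiv ℝ F (y, t)).comp (ContinuousLinearMap.inl ℝ E ℝ))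
      (bound := fun _ => M) (Metric.closedBall_mem_nhds x one_pos) ?_ ?_ ?_ ?_ ?_ ?_
    · refine Filter.Eventually.of_forall fun y => ?_
      exact (hF.continuous.comp (Continuous.prodMk_right y)).aestronglyMeasurable
    · exact (hF.continuous.comp (Continuous.prodMk_right x)).intervalIntegrable _ _
    · exact (hF'.comp (Continuous.prodMk_right x)).aestronglyMeasurable
    · refine Filter.Eventually.of_forall fun t ht y hy => hM (y, t) ⟨hy, ?_⟩
      rw [Set.uIoc_of_le zero_le_one] at ht
      exact ⟨ht.1.le, ht.2⟩
    · exact intervalIntegrable_const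
    · refine Filter.Eventually.of_forall fun t _ y _ => ?_
      have h1 : HasFDerivAt F (fderiv ℝ F (y, t)) (y, t) :=
        (hF.differentiable (by simp) _).hasFDerivAt
      exact h1.comp y (hasFDerivAt_prodMk_left y t)
  induction n with
  | zero =>
    intro G _ _ _ F hF
    rw [Nat.cast_zero, contDiff_zero]
    exact continuous_iff_continuousAt.2 fun x => (hder F hF x).continuousAt
  | succ n ih =>
    intro G _ _ _ F hF
    rw [Nat.cast_succ, contDiff_succ_iff_hasFDerivAt]
    refine ⟨_, ih (fun p => (fderiv ℝ F p).comp (ContinuousLinearMap.inl ℝ E ℝ)) ?_, hder F hF⟩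
    exact (hF.fderiv_right (m := ∞) (by simp)).clm_comp contDiff_const

namespace SmoothFn

/-- Hadamard's lemma. -/
theorem hadamard {n : ℕ} (f : SmoothFn n) : ∃ g : Fin n → SmoothFn (n + n),
    ∀ z : Fin (n + n) → ℝ, f (fun i => z (Fin.castAdd n i)) - f (fun i => z (Fin.natAdd n i)) =
      ∑ i, (z (Fin.castAdd n i) - z (Fin.natAdd n i)) * g i z := by
  let L : (Fin (n + n) → ℝ) → (Fin n → ℝ) := fun z i => z (Fin.castAdd n i)
  let R : (Fin (n + n) → ℝ) → (Fin n → ℝ) := fun z i => z (Fin.natAdd n i)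
  have hL : ContDiff ℝ ∞ L := by fun_prop
  have hR : ContDiff ℝ ∞ R := by fun_prop
  let F : Fin n → (Fin (n + n) → ℝ) × ℝ → ℝ := fun i p =>
    fderiv ℝ f.toFun (R p.1 + p.2 • (L p.1 - R p.1)) (Pi.single i 1)
  have hF : ∀ i, ContDiff ℝ ∞ (F i) := by
    intro i
    have h1 : ContDiff ℝ ∞ (fun p : (Fin (n + n) → ℝ) × ℝ => R p.1 + p.2 • (L p.1 - R p.1)) :=
      (hR.comp contDiff_fst).add
        (contDiff_snd.smul ((hL.comp contDiff_fst).sub (hR.comp contDiff_fst)))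
    exact ((f.smooth.fderiv_right (m := ∞) (by simp)).comp h1).clm_apply contDiff_const
  refine ⟨fun i => ⟨fun z => ∫ t in (0 : ℝ)..1, F i (z, t),
    contDiff_infty.2 fun k => contDiff_nat_parametric_integral k _ (hF i)⟩, fun z => ?_⟩
  have hderiv : ∀ t ∈ Set.uIcc (0 : ℝ) 1, HasDerivAt (fun t : ℝ => f (R z + t • (L z - R z)))
      (∑ i, (L z i - R z i) * F i (z, t)) t := by
    intro t _
    have h1 : HasFDerivAt f.toFun (fderiv ℝ f.toFun (R z + t • (L z - R z)))
        (R z + t • (L z - R z)) := (f.smooth.differentiable (by simp) _).hasFDerivAt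
    have h2 : HasDerivAt (fun t : ℝ => R z + t • (L z - R z)) (L z - R z) t := by
      simpa using ((hasDerivAt_id t).smul_const (L z - R z)).const_add (R z)
    have h3 := h1.comp_hasDerivAt t h2
    have h4 : fderiv ℝ f.toFun (R z + t • (L z - R z)) (L z - R z) =
        ∑ i, (L z i - R z i) * F i (z, t) := by
      have h5 := congrArg (fderiv ℝ f.toFun (R z + t • (L z - R z)))
        (Finset.univ_sum_single (L z - R z))
      rw [← h5, map_sum]
      refine Finset.sum_congr rfl fun i _ => ?_
      rw [← smul_eq_mul, ← map_smul, ← Pi.single_smul]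
      simp
    rw [← h4]
    exact h3
  have hint : IntervalIntegrable (fun t => ∑ i, (L z i - R z i) * F i (z, t))
      MeasureTheory.volume 0 1 := by
    refine Continuous.intervalIntegrable ?_ _ _
    exact continuous_finsetSum _ fun i _ =>
      continuous_const.mul ((hF i).continuous.comp (Continuous.prodMk_right z))
  have h := intervalIntegral.integral_eq_sub_of_hasDerivAt hderiv hint
  rw [intervalIntegral.integral_finsetSum] at h
  · simp only [intervalIntegral.integral_const_mul, one_smul, zero_smul, add_zero,
      add_sub_cancel] at h
    exact h.symm
  · intro i _
    exact (continuous_const.mul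
      ((hF i).continuous.comp (Continuous.prodMk_right z))).intervalIntegrable _ _

/-- Evaluation of smooth functions at a tuple of elements of a C^∞-ring. -/
def evalHom {A : Type u} [CInfRing A] {n : ℕ} (v : Fin n → A) : CInfHom (SmoothFn n) A :=
  ⟨fun f => CInfRing.op f v, fun f a => CInfRing.op_comp f a v⟩

/-- Evaluation of a smooth function at a point, as a ring homomorphism. -/
def evalPoint {n : ℕ} (x : Fin n → ℝ) : SmoothFn n →+* ℝ where
  toFun f := f x
  map_zero' := rfl
  map_one' := rfl
  map_add' _ _ := rfl
  map_mul' _ _ := rfl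

end SmoothFn

/-- Every ideal of a C^∞-ring is a congruence for all smooth operations. -/
theorem CInfRing.op_sub_op_mem {A : Type u} [CInfRing A] (I : Ideal A) {n : ℕ} (f : SmoothFn n)
    (a b : Fin n → A) (h : ∀ i, a i - b i ∈ I) : CInfRing.op f a - CInfRing.op f b ∈ I := by
  obtain ⟨g, hg⟩ := f.hadamard
  have key : f.comp (fun i => SmoothFn.proj (Fin.castAdd n i)) -
      f.comp (fun i => SmoothFn.proj (Fin.natAdd n i)) =
      ∑ i, (SmoothFn.proj (Fin.castAdd n i) - SmoothFn.proj (Fin.natAdd n i)) * g i := by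
    refine SmoothFn.ext (funext fun z => ?_)
    have := hg z
    change SmoothFn.evalPoint z (_ - _) = SmoothFn.evalPoint z (∑ i, _)
    simp only [map_sub, map_sum, map_mul]
    exact this
  have h2 := congrArg (SmoothFn.evalHom (Fin.append a b)).toRingHom key
  simp only [map_sub, map_sum, map_mul] at h2
  have hp : ∀ k, (SmoothFn.evalHom (Fin.append a b)).toRingHom (SmoothFn.proj k) =
      Fin.append a b k := fun k => CInfRing.op_proj _ _
  have hl : (SmoothFn.evalHom (Fin.append a b)).toRingHom
      (f.comp (fun i => SmoothFn.proj (Fin.castAdd n i))) = CInfRing.op f a := by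
    refine (CInfRing.op_comp _ _ _).trans ?_
    simp only [CInfRing.op_proj, Fin.append_left]
  have hr : (SmoothFn.evalHom (Fin.append a b)).toRingHom
      (f.comp (fun i => SmoothFn.proj (Fin.natAdd n i))) = CInfRing.op f b := by
    refine (CInfRing.op_comp _ _ _).trans ?_
    simp only [CInfRing.op_proj, Fin.append_right]
  rw [hl, hr] at h2
  rw [h2]
  refine Ideal.sum_mem _ fun i _ => ?_
  rw [hp, hp, Fin.append_left, Fin.append_right]
  exact Ideal.mul_mem_right _ _ (h i)

/-- The quotient `A/I` of a C^∞-ring by an ideal of its underlying ring. -/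
def CInfQuotient {A : Type u} [CInfRing A] (I : Ideal A) : Type u := A ⧸ I

namespace CInfQuotient

variable {A : Type u} [CInfRing A] (I : Ideal A)

/-- The class of an element. -/
def cls (a : A) : CInfQuotient I := Ideal.Quotient.mk I a

theorem cls_op_out {n : ℕ} (f : SmoothFn n) (a : Fin n → A) :
    cls I (CInfRing.op f fun i => Quotient.out (s := Submodule.quotientRel I) (cls I (a i))) =
      cls I (CInfRing.op f a) := by
  refine Ideal.Quotient.eq.2 (CInfRing.op_sub_op_mem I f _ _ fun i => ?_)
  exact Ideal.Quotient.eq.1 (Quotient.out_eq (s := Submodule.quotientRel I) (cls I (a i)))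

theorem cls_surjective : Function.Surjective (cls I) := Ideal.Quotient.mk_surjective

/-- The operations of `A/I` are those of `A` on representatives (see `CInfQuotient.mk`). -/
noncomputable instance : CInfRing (CInfQuotient I) where
  op f q := cls I (CInfRing.op f fun i => Quotient.out (s := Submodule.quotientRel I) (q i))
  op_proj i q := by
    rw [CInfRing.op_proj]
    exact Quotient.out_eq (s := Submodule.quotientRel I) (q i)
  op_comp g f q := by
    rw [CInfRing.op_comp, cls_op_out]

/-- The projection `A → A/I`. -/
noncomputable def mk : CInfHom A (CInfQuotient I) := ⟨cls I, fun f a => (cls_op_out I f a).symm⟩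

end CInfQuotient

/-! ## Presentations by generators and relations -/

/-- Formal expressions in generators `G`, built from smooth operations. -/
inductive CInfTerm (G : Type u) : Type u
  | var : G → CInfTerm G
  | op : {n : ℕ} → SmoothFn n → (Fin n → CInfTerm G) → CInfTerm G

/-- The smallest C^∞-congruence on expressions that contains the relations `r`. -/
inductive CInfTerm.Rel {G : Type u} (r : CInfTerm G → CInfTerm G → Prop) :
    CInfTerm G → CInfTerm G → Prop
  | of {s t} : r s t → Rel r s t
  | refl (s) : Rel r s s
  | symm {s t} : Rel r s t → Rel r t s
  | trans {s t p} : Rel r s t → Rel r t p → Rel r s p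
  | congr {n : ℕ} (f : SmoothFn n) (s t : Fin n → CInfTerm G) :
      (∀ i, Rel r (s i) (t i)) → Rel r (.op f s) (.op f t)
  | proj {n : ℕ} (i : Fin n) (s : Fin n → CInfTerm G) : Rel r (.op (SmoothFn.proj i) s) (s i)
  | comp {m n : ℕ} (g : SmoothFn m) (f : Fin m → SmoothFn n) (s : Fin n → CInfTerm G) :
      Rel r (.op (g.comp f) s) (.op g fun j => .op (f j) s)

/-- The congruence as a setoid. -/
def CInfTerm.setoid {G : Type u} (r : CInfTerm G → CInfTerm G → Prop) : Setoid (CInfTerm G) where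
  r := CInfTerm.Rel r
  iseqv := ⟨.refl, .symm, .trans⟩

/-- The C^∞-ring with generators `G` and relations `r`. -/
def CInfPresented {G : Type u} (r : CInfTerm G → CInfTerm G → Prop) : Type u :=
  Quotient (CInfTerm.setoid r)

namespace CInfPresented

variable {G : Type u} {r : CInfTerm G → CInfTerm G → Prop}

/-- The class of an expression. -/
def cls (r : CInfTerm G → CInfTerm G → Prop) (t : CInfTerm G) : CInfPresented r :=
  Quotient.mk (CInfTerm.setoid r) t

theorem cls_eq {s t : CInfTerm G} (h : CInfTerm.Rel r s t) : cls r s = cls r t :=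
  Quotient.sound (s := CInfTerm.setoid r) h

theorem cls_op_out {n : ℕ} (f : SmoothFn n) (s : Fin n → CInfTerm G) :
    cls r (.op f fun i => Quotient.out (s := CInfTerm.setoid r) (cls r (s i))) =
      cls r (.op f s) :=
  cls_eq (.congr f _ _ fun i => Quotient.mk_out (s := CInfTerm.setoid r) (s i))

theorem cls_out (q : CInfPresented r) : cls r (Quotient.out (s := CInfTerm.setoid r) q) = q :=
  Quotient.out_eq (s := CInfTerm.setoid r) q

noncomputable instance : CInfRing (CInfPresented r) where
  op f q := cls r (.op f fun i => Quotient.out (s := CInfTerm.setoid r) (q i))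
  op_proj i q := by
    rw [cls_eq (.proj i _), cls_out]
  op_comp g f q := by
    rw [cls_eq (.comp g f _)]
    exact (cls_op_out g _).symm

theorem op_cls {n : ℕ} (f : SmoothFn n) (s : Fin n → CInfTerm G) :
    CInfRing.op f (fun i => cls r (s i)) = cls r (.op f s) := cls_op_out f s

end CInfPresented

/-- The value of an expression under an assignment of the generators. -/
def CInfTerm.eval {G : Type u} {B : Type v} [CInfRing B] (x : G → B) : CInfTerm G → B
  | .var g => x g
  | .op f s => CInfRing.op f fun i => (s i).eval x

theorem CInfTerm.eval_eq_of_rel {G : Type u} {r : CInfTerm G → CInfTerm G → Prop} {B : Type v}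
    [CInfRing B] (x : G → B) (hx : ∀ s t, r s t → s.eval x = t.eval x) {s t : CInfTerm G}
    (h : CInfTerm.Rel r s t) : s.eval x = t.eval x := by
  induction h with
  | of h => exact hx _ _ h
  | refl => rfl
  | symm _ ih => exact ih.symm
  | trans _ _ ih1 ih2 => exact ih1.trans ih2
  | congr f s t _ ih => simp only [CInfTerm.eval, ih]
  | proj i s => simp only [CInfTerm.eval, CInfRing.op_proj]
  | comp g f s => simp only [CInfTerm.eval, CInfRing.op_comp]

namespace CInfPresented

variable {G : Type u} {r : CInfTerm G → CInfTerm G → Prop}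

/-- The universal property of a presentation: existence. -/
def lift {B : Type v} [CInfRing B] (x : G → B) (hx : ∀ s t, r s t → s.eval x = t.eval x) :
    CInfHom (CInfPresented r) B where
  toFun := Quotient.lift (s := CInfTerm.setoid r) (fun t => t.eval x)
    fun _ _ h => CInfTerm.eval_eq_of_rel x hx h
  map_op f q := by
    obtain ⟨s, rfl⟩ : ∃ s : _ → CInfTerm G, q = fun i => cls r (s i) :=
      ⟨fun i => Quotient.out (s := CInfTerm.setoid r) (q i), funext fun i => (cls_out _).symm⟩
    rw [op_cls]
    rfl

/-- The universal property of a presentation: uniqueness. -/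
theorem hom_ext {B : Type v} [CInfRing B] {φ ψ : CInfHom (CInfPresented r) B}
    (h : ∀ g, φ (cls r (.var g)) = ψ (cls r (.var g))) : φ = ψ := by
  have key : ∀ t, φ (cls r t) = ψ (cls r t) := by
    intro t
    induction t with
    | var g => exact h g
    | op f s ih => rw [← op_cls, φ.map_op, ψ.map_op]; simp only [ih]
  refine CInfHom.ext (funext fun q => ?_)
  rw [← cls_out q]
  exact key _

end CInfPresented

/-! ## Inverting an element -/

/-- Relations of the localization: those of `A`, and `a · x = 1` for the new generator `x`. -/
inductive CInfLocalization.Rel {A : Type u} [CInfRing A] (a : A) :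
    CInfTerm (Option A) → CInfTerm (Option A) → Prop
  | op {n : ℕ} (f : SmoothFn n) (v : Fin n → A) :
      Rel a (.var (some (CInfRing.op f v))) (.op f fun i => .var (some (v i)))
  | inv : Rel a (.op SmoothFn.mulFn ![.var (some a), .var none]) (.var (some 1))

/-- `A{a⁻¹}`: the C^∞-ring obtained from `A` by inverting `a` in the category of C^∞-rings. -/
abbrev CInfLocalization {A : Type u} [CInfRing A] (a : A) : Type u :=
  CInfPresented (CInfLocalization.Rel a)

/-! ## The category of C^∞-rings and its opposite -/

/-- The category of C^∞-rings. -/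
structure CInfRingCat : Type (u + 1) where
  carrier : Type u
  [str : CInfRing carrier]

namespace CInfRingCat

instance : CoeSort CInfRingCat.{u} (Type u) := ⟨CInfRingCat.carrier⟩

instance (A : CInfRingCat.{u}) : CInfRing A := A.str

instance : Category.{u} CInfRingCat.{u} where
  Hom A B := CInfHom A B
  id A := CInfHom.id A
  comp f g := CInfHom.comp g f

/-- A morphism in the category as a morphism of C^∞-rings. -/
abbrev hom {A B : CInfRingCat.{u}} (f : A ⟶ B) : CInfHom A B := f

/-- A morphism of C^∞-rings as a morphism in the category. -/
abbrev ofHom {A B : CInfRingCat.{u}} (f : CInfHom A B) : A ⟶ B := f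

/-- Relations of the coproduct: those of each summand. -/
inductive CoprodRel {J : Type} (A : J → CInfRingCat.{u}) :
    CInfTerm (Σ j, A j) → CInfTerm (Σ j, A j) → Prop
  | op (j : J) {n : ℕ} (f : SmoothFn n) (v : Fin n → A j) :
      CoprodRel A (.var ⟨j, CInfRing.op f v⟩) (.op f fun i => .var ⟨j, v i⟩)

/-- The coproduct of a family of C^∞-rings, with its inclusions. -/
noncomputable def coprodCofan {J : Type} (A : J → CInfRingCat.{u}) : Cofan A :=
  Cofan.mk (⟨CInfPresented (CoprodRel A)⟩ : CInfRingCat.{u}) fun j =>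
    { toFun := fun a => CInfPresented.cls _ (.var ⟨j, a⟩)
      map_op := fun f v => by
        rw [CInfPresented.op_cls]
        exact CInfPresented.cls_eq (.of (.op j f v)) }

/-- It is a coproduct. -/
noncomputable def coprodCofanIsColimit {J : Type} (A : J → CInfRingCat.{u}) :
    IsColimit (coprodCofan A) :=
  Cofan.IsColimit.mk _
    (fun s => ofHom (CInfPresented.lift (fun g => hom (s.inj g.1) g.2) (by
      rintro _ _ ⟨j, f, v⟩
      exact (hom (s.inj j)).map_op f v)))
    (fun _ _ => rfl)
    (fun s m hm => CInfPresented.hom_ext fun g =>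
      congrFun (congrArg (fun φ => (hom φ).toFun) (hm g.1)) g.2)

instance : HasCoproducts.{0} CInfRingCat.{u} :=
  hasCoproducts_of_colimit_cofans coprodCofan coprodCofanIsColimit

instance : HasFiniteCoproducts CInfRingCat.{u} := ⟨fun _ => inferInstance⟩

end CInfRingCat

/-- The category of (affine) C^∞-schemes: the opposite of the category of C^∞-rings. For
`X : CInfScheme`, the C^∞-ring `C^∞(X)` is `X.unop`. -/
abbrev CInfScheme : Type (u + 1) := CInfRingCat.{u}ᵒᵖ

/-- The category of presheaves of sets on C^∞-schemes. -/
abbrev CInfPresheaf : Type (u + 1) := CInfScheme.{u}ᵒᵖ ⥤ Type u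

/-- For a morphism `Φ : X' ⟶ X`, the morphism `C^∞(X) → C^∞(X')`. -/
abbrev CInfScheme.pullback {X' X : CInfScheme.{u}} (Φ : X' ⟶ X) : CInfHom X.unop X'.unop :=
  CInfRingCat.hom Φ.unop

/-! ## The two radicals and the two infinitesimal neighbourhoods -/

/-- The `∞`-radical of an ideal `I`: all `f` with `(A/I){f⁻¹} ≅ {0}`. -/
def infRadical {A : Type u} [CInfRing A] (I : Ideal A) : Set A :=
  {f | Subsingleton (CInfLocalization (CInfQuotient.mk I f))}

/-- The two kinds of nilpotence. -/
inductive NilKind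
  | nilpotent
  | infNilpotent

/-- The nilradical of an ideal, respectively its `∞`-radical. -/
def NilKind.radical {A : Type u} [CInfRing A] : NilKind → Ideal A → Set A
  | .nilpotent, I => (I.radical : Set A)
  | .infNilpotent, I => infRadical I

section Neighbourhoods

variable {A : Type u} {A' : Type u} [CInfRing A] [CInfRing A']

/-- The ideals of `A` that have the same radical as the kernel of `φ : A → A'`. -/
def NilKind.ideals (κ : NilKind) (φ : CInfHom A A') : Set (Ideal A) :=
  {I | κ.radical I = κ.radical φ.ker}

/-- The elements with vanishing infinite jet. -/
def jetIdeal (φ : CInfHom A A') : Ideal A := sInf (NilKind.nilpotent.ideals φ)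

/-- The elements with vanishing germ. -/
def germIdeal (φ : CInfHom A A') : Ideal A where
  carrier := {a | ∃ b, a * b = 0 ∧ IsUnit (φ b)}
  zero_mem' := ⟨1, by simp, by
    rw [show φ 1 = 1 from φ.toRingHom.map_one]; exact isUnit_one⟩
  add_mem' := by
    rintro a₁ a₂ ⟨b₁, h₁, u₁⟩ ⟨b₂, h₂, u₂⟩
    refine ⟨b₁ * b₂, ?_, ?_⟩
    · linear_combination b₂ * h₁ + b₁ * h₂
    · rw [show φ (b₁ * b₂) = φ b₁ * φ b₂ from φ.toRingHom.map_mul _ _]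
      exact u₁.mul u₂
  smul_mem' := by
    rintro c a ⟨b, h, hu⟩
    exact ⟨b, by rw [smul_eq_mul, mul_assoc, h, mul_zero], hu⟩

/-- The elements with vanishing jet, respectively vanishing germ. -/
def NilKind.vanishing (κ : NilKind) (φ : CInfHom A A') : Ideal A :=
  match κ with
  | .nilpotent => jetIdeal φ
  | .infNilpotent => germIdeal φ

/-- The linear topology on `A` modulo the elements with vanishing jet (germ): it is generated by
the images of the cosets of the ideals in `κ.ideals φ`. -/
@[reducible]
def NilKind.topology (κ : NilKind) (φ : CInfHom A A') :
    TopologicalSpace (CInfQuotient (κ.vanishing φ)) :=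
  TopologicalSpace.generateFrom
    {U | ∃ I ∈ κ.ideals φ, ∃ a : A, U = CInfQuotient.mk (κ.vanishing φ) '' {x | x - a ∈ I}}

end Neighbourhoods

namespace NilKind

/-- For `Φ : X' ⟶ X`, the pro-nilpotent (respectively `∞`-nilpotent) neighbourhood of `X'` in `X`:
the presheaf whose sections over `T` are the continuous morphisms of C^∞-rings from `C^∞(X)` modulo
the elements with vanishing jet (germ) at `X'`, with its linear topology, to the discrete
`C^∞(T)`. -/
noncomputable def nbhd (κ : NilKind) {X' X : CInfScheme.{u}} (Φ : X' ⟶ X) : CInfPresheaf.{u} where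
  obj T := {ψ : CInfHom (CInfQuotient (κ.vanishing (CInfScheme.pullback Φ))) T.unop.unop //
    @Continuous _ _ (κ.topology (CInfScheme.pullback Φ)) ⊥ ψ}
  map f := ↾fun ψ => ⟨CInfHom.comp (CInfScheme.pullback f.unop) ψ.1,
    @Continuous.comp _ _ _ (κ.topology (CInfScheme.pullback Φ)) ⊥ ⊥ ψ.1.toFun
      (CInfScheme.pullback f.unop).toFun continuous_bot ψ.2⟩

/-- The canonical morphism of the neighbourhood to the presheaf represented by `X`. -/
noncomputable def nbhdι (κ : NilKind) {X' X : CInfScheme.{u}} (Φ : X' ⟶ X) :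
    κ.nbhd Φ ⟶ yoneda.obj X where
  app T := ↾fun ψ => (CInfRingCat.ofHom (CInfHom.comp ψ.1 (CInfQuotient.mk _))).op

instance (κ : NilKind) {X' X : CInfScheme.{u}} (Φ : X' ⟶ X) (T : CInfScheme.{u}ᵒᵖ) :
    Mono ((κ.nbhdι Φ).app T) := by
  rw [mono_iff_injective]
  intro ψ₁ ψ₂ h
  have h' : CInfHom.comp ψ₁.1 (CInfQuotient.mk _) = CInfHom.comp ψ₂.1 (CInfQuotient.mk _) :=
    Quiver.Hom.op_inj h
  refine Subtype.ext (CInfHom.ext (funext fun q => ?_))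
  obtain ⟨a, rfl⟩ := CInfQuotient.cls_surjective _ q
  exact congrFun (congrArg CInfHom.toFun h') a

instance (κ : NilKind) {X' X : CInfScheme.{u}} (Φ : X' ⟶ X) : Mono (κ.nbhdι Φ) :=
  NatTrans.mono_of_mono_app _

end NilKind

/-! ## Presheaves of groupoids and their nerves -/

section Groupoids

variable {C : Type u} [Category.{v} C]

/-- A sub-groupoid of a presheaf of groupoids: a sub-groupoid over every object, stable under
restriction. -/
structure SubgroupoidPresheaf (𝒢 : Cᵒᵖ ⥤ Grpd.{0, w}) where
  obj : ∀ T : Cᵒᵖ, Subgroupoid (𝒢.obj T)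
  map_mem : ∀ {S T : Cᵒᵖ} (f : S ⟶ T) {x y : 𝒢.obj S} {p : x ⟶ y},
    p ∈ (obj S).arrows x y → (𝒢.map f).map p ∈ (obj T).arrows ((𝒢.map f).obj x) ((𝒢.map f).obj y)

/-- Restriction along `f`, on the sub-groupoids. -/
def SubgroupoidPresheaf.restrict {𝒢 : Cᵒᵖ ⥤ Grpd.{0, w}} (H : SubgroupoidPresheaf 𝒢)
    {S T : Cᵒᵖ} (f : S ⟶ T) : (H.obj S).objs ⥤ (H.obj T).objs where
  obj x := ⟨(𝒢.map f).obj x.1, _, H.map_mem f x.2.choose_spec⟩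
  map p := ⟨(𝒢.map f).map p.1, H.map_mem f p.2⟩
  map_id _ := Subtype.ext ((𝒢.map f).map_id _)
  map_comp _ _ := Subtype.ext ((𝒢.map f).map_comp _ _)

theorem Subgroupoid.functor_ext {K : Type*} [Category* K] {D : Type*} [Groupoid D]
    {S : Subgroupoid D} {F G : K ⥤ S.objs} (h : F ⋙ S.hom = G ⋙ S.hom) : F = G := by
  have hobj : ∀ x, F.obj x = G.obj x := fun x => Subtype.ext (Functor.congr_obj h x)
  refine CategoryTheory.Functor.ext hobj fun x y p => Subgroupoid.hom.faithful S _ _ ?_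
  have := Functor.congr_hom h p
  simp only [Functor.comp_map] at this
  simp only [Functor.map_comp, eqToHom_map]
  exact this

/-- A sub-groupoid as a presheaf of groupoids. -/
def SubgroupoidPresheaf.toGrpd {𝒢 : Cᵒᵖ ⥤ Grpd.{0, w}} (H : SubgroupoidPresheaf 𝒢) :
    Cᵒᵖ ⥤ Grpd.{0, w} where
  obj T := Grpd.of (H.obj T).objs
  map f := H.restrict f
  map_id T := Subgroupoid.functor_ext (congrArg ((H.obj T).hom ⋙ ·) (𝒢.map_id T))
  map_comp f g :=
    Subgroupoid.functor_ext (congrArg ((H.obj _).hom ⋙ ·) (𝒢.map_comp f g))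

/-- The inclusion of a sub-groupoid. -/
def SubgroupoidPresheaf.incl {𝒢 : Cᵒᵖ ⥤ Grpd.{0, w}} (H : SubgroupoidPresheaf 𝒢) :
    H.toGrpd ⟶ 𝒢 where
  app T := (H.obj T).hom
  naturality _ _ _ := rfl

/-- The simplicial presheaf given by the nerves of the groupoids of a presheaf of groupoids. -/
def nervePresheaf : (Cᵒᵖ ⥤ Grpd.{0, w}) ⥤ SimplicialObject (Cᵒᵖ ⥤ Type w) :=
  (Functor.whiskeringRight Cᵒᵖ Grpd.{0, w} (SimplexCategoryᵒᵖ ⥤ Type w)).obj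
    (Grpd.forgetToCat ⋙ nerveFunctor) ⋙ flipFunctor Cᵒᵖ SimplexCategoryᵒᵖ (Type w)

end Groupoids

/-! ## The pair groupoid of a C^∞-scheme and the neighbourhoods of the diagonals -/

/-- The codiscrete category on a set is a groupoid, with exactly one arrow from `x` to `y` for each
pair `(x, y)`. -/
instance (A : Type u) : Groupoid (Codiscrete A) where
  inv _ := ()

namespace CInfScheme

/-- The pair groupoid of `X`, as a presheaf of groupoids: the objects over `T` are the sections
`x ∈ Hom(T, X)`, the arrows over `T` are the pairs `(x, y) ∈ Hom(T, X) × Hom(T, X)`, with source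
`x` and target `y`, and `(x, y)` composed with `(y, z)` is `(x, z)`. -/
def pairGroupoid (X : CInfScheme.{u}) : CInfScheme.{u}ᵒᵖ ⥤ Grpd.{0, u} where
  obj T := Grpd.of (Codiscrete (T.unop ⟶ X))
  map f := Codiscrete.functorOfFun fun x => f.unop ≫ x
  map_id _ := CategoryTheory.Functor.ext
    (fun x => Codiscrete.ext (Category.id_comp x.as)) (fun _ _ _ => rfl)
  map_comp f g := CategoryTheory.Functor.ext
    (fun x => Codiscrete.ext (Category.assoc g.unop f.unop x.as)) (fun _ _ _ => rfl)

/-- The simplicial C^∞-scheme `X^•` of cartesian powers: `X^{k+1}` in degree `k`, with the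
projections and diagonals as structure morphisms. -/
noncomputable abbrev powers (X : CInfScheme.{u}) : SimplicialObject CInfScheme.{u} :=
  cechNerveTerminalFrom X

/-- The simplicial presheaf represented by `X^•`. -/
noncomputable abbrev powersPresheaf (X : CInfScheme.{u}) : SimplicialObject CInfPresheaf.{u} :=
  X.powers ⋙ yoneda

/-- The `i`-th projection `X^{k+1} ⟶ X`. -/
noncomputable def powerπ (X : CInfScheme.{u}) (n : SimplexCategoryᵒᵖ)
    (i : Fin (n.unop.len + 1)) : X.powers.obj n ⟶ X :=
  Pi.π (fun _ : Fin (n.unop.len + 1) => X) i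

/-- The morphism `T ⟶ X^{k+1}` with given components. -/
noncomputable def tuple {T X : CInfScheme.{u}} (n : SimplexCategoryᵒᵖ)
    (x : Fin (n.unop.len + 1) → (T ⟶ X)) : T ⟶ X.powers.obj n :=
  Pi.lift x

theorem tuple_π {T X : CInfScheme.{u}} (n : SimplexCategoryᵒᵖ)
    (x : Fin (n.unop.len + 1) → (T ⟶ X)) (i : Fin (n.unop.len + 1)) :
    tuple n x ≫ X.powerπ n i = x i := Pi.lift_π _ _

theorem powers_map_π (X : CInfScheme.{u}) {m n : SimplexCategoryᵒᵖ} (θ : m ⟶ n)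
    (i : Fin (n.unop.len + 1)) :
    X.powers.map θ ≫ X.powerπ n i = X.powerπ m (θ.unop.toOrderHom i) := Pi.lift_π _ _

theorem powers_hom_ext {T X : CInfScheme.{u}} {n : SimplexCategoryᵒᵖ} {f g : T ⟶ X.powers.obj n}
    (h : ∀ i, f ≫ X.powerπ n i = g ≫ X.powerπ n i) : f = g := Pi.hom_ext _ _ h

theorem comp_tuple {S T X : CInfScheme.{u}} (n : SimplexCategoryᵒᵖ) (f : S ⟶ T)
    (x : Fin (n.unop.len + 1) → (T ⟶ X)) : f ≫ tuple n x = tuple n fun i => f ≫ x i :=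
  powers_hom_ext fun i => by rw [Category.assoc, tuple_π, tuple_π]

theorem tuple_map {T X : CInfScheme.{u}} {m n : SimplexCategoryᵒᵖ} (θ : m ⟶ n)
    (x : Fin (m.unop.len + 1) → (T ⟶ X)) :
    tuple m x ≫ X.powers.map θ = tuple n fun i => x (θ.unop.toOrderHom i) :=
  powers_hom_ext fun i => by rw [Category.assoc, powers_map_π, tuple_π, tuple_π]

/-- The main diagonal `X ⟶ X^{k+1}`. -/
noncomputable def diagonal (X : CInfScheme.{u}) (n : SimplexCategoryᵒᵖ) : X ⟶ X.powers.obj n :=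
  tuple n fun _ => 𝟙 X

/-- The nerve of the pair groupoid of `X` is `X^•`: a simplex corresponds to the tuple of its
vertices. -/
noncomputable def pairNerveIso (X : CInfScheme.{u}) :
    nervePresheaf.obj X.pairGroupoid ≅ X.powersPresheaf :=
  NatIso.ofComponents (fun n => NatIso.ofComponents (fun T =>
    Equiv.toIso
      { toFun := fun (F : ComposableArrows (Codiscrete (T.unop ⟶ X)) n.unop.len) =>
          tuple n fun i => (F.obj i).as
        invFun := fun g => Codiscrete.functor fun i => g ≫ X.powerπ n i
        left_inv := fun F => CategoryTheory.Functor.ext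
          (fun i => Codiscrete.ext (tuple_π n _ i)) (fun _ _ _ => rfl)
        right_inv := fun g => powers_hom_ext fun i => tuple_π n _ i })
    (fun {S T} f => by
      ext F
      exact (comp_tuple n f.unop _).symm))
    (fun {m n} θ => by
      ext T F
      let F' : ComposableArrows (Codiscrete (T.unop ⟶ X)) m.unop.len := F
      exact (tuple_map (T := T.unop) θ fun i => (F'.obj i).as).symm)

end CInfScheme

namespace NilKind

/-- The neighbourhood of the main diagonal in `X^{k+1}`. -/
noncomputable abbrev diagNbhd (κ : NilKind) (X : CInfScheme.{u}) (n : SimplexCategoryᵒᵖ) :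
    CInfPresheaf.{u} :=
  κ.nbhd (X.diagonal n)

/-- Its canonical morphism to `X^{k+1}`. -/
noncomputable abbrev diagNbhdι (κ : NilKind) (X : CInfScheme.{u}) (n : SimplexCategoryᵒᵖ) :
    κ.diagNbhd X n ⟶ X.powersPresheaf.obj n :=
  κ.nbhdι (X.diagonal n)

/-- The simplicial structure morphisms of `X^•` restrict to the neighbourhoods of the main
diagonals. -/
def Restricts (κ : NilKind) (X : CInfScheme.{u}) : Prop :=
  ∀ {m n : SimplexCategoryᵒᵖ} (θ : m ⟶ n), ∃ g : κ.diagNbhd X m ⟶ κ.diagNbhd X n,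
    g ≫ κ.diagNbhdι X n = κ.diagNbhdι X m ≫ X.powersPresheaf.map θ

/-- The simplicial presheaf formed by the neighbourhoods of the main diagonals in all cartesian
powers of `X`, with the structure morphisms restricted from `X^•` (unique, as the neighbourhoods
are sub-presheaves). -/
noncomputable def diagNbhdSimplicial (κ : NilKind) (X : CInfScheme.{u}) (h : κ.Restricts X) :
    SimplicialObject CInfPresheaf.{u} where
  obj n := κ.diagNbhd X n
  map θ := (h θ).choose
  map_id n := by
    rw [← cancel_mono (κ.diagNbhdι X n), (h (𝟙 n)).choose_spec, CategoryTheory.Functor.map_id,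
      Category.comp_id, Category.id_comp]
  map_comp {l m n} θ θ' := by
    rw [← cancel_mono (κ.diagNbhdι X n), (h (θ ≫ θ')).choose_spec, Category.assoc,
      (h θ').choose_spec, ← Category.assoc, (h θ).choose_spec, Category.assoc, ← Functor.map_comp]

/-- The inclusion of this simplicial presheaf into `X^•`. -/
noncomputable def diagNbhdSimplicialι (κ : NilKind) (X : CInfScheme.{u}) (h : κ.Restricts X) :
    κ.diagNbhdSimplicial X h ⟶ X.powersPresheaf where
  app n := κ.diagNbhdι X n
  naturality _ _ θ := (h θ).choose_spec

end NilKind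

/-! Call an element of a C^∞-ring infinitesimal if it lies in the κ-radical of the zero ideal, and
call two `T`-points of `X` close if every function on `X` takes values at them that differ by an
infinitesimal of `C^∞(T)` (`InfClose`). Closeness is an equivalence relation because the radical is
an ideal, and it is stable under restriction because morphisms preserve infinitesimals. Everything
follows once the neighbourhood of the main diagonal in `X^{k+1}` is identified with the tuples of
pairwise close points (`mem_range_diagNbhdι_iff`): an arrow of the sub-groupoid is a close pair, a
simplex of its nerve is a tuple of pairwise close vertices, and the simplicial structure morphisms
only repeat, omit or permute coordinates.

The identification has two halves. By `mem_range_nbhdι_iff`, a point `ψ` lies in the neighbourhood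
of a closed `X'` exactly when all functions vanishing on `X'` become infinitesimal under `ψ`. By
`ker_diagonal_le`, the ideal of the diagonal is contained in any ideal containing the differences of
the coordinates, so it suffices to test those.

For nilpotents the algebra of radicals is classical. For the `∞`-radical all of it rests on
`mem_infRadical_iff`: `f` belongs to the radical of `I` if and only if `g(f) ∈ I` for a smooth `g`
on the line that vanishes at most at the origin. Its analytic input is flat division,
`exists_comp_eq_mul_of_zeros_subset`; the same result shows that this radical is an ideal. -/

/-! ## Flat division -/

/-- Every sequence of smooth functions has small positive multiples whose sum is smooth. -/
theorem exists_pos_forall_contDiff_tsum {E : Type*} [NormedAddCommGroup E] [NormedSpace ℝ E]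
    [FiniteDimensional ℝ E] (f : ℕ → E → ℝ) (hf : ∀ k, ContDiff ℝ ∞ (f k)) :
    ∃ ε : ℕ → ℝ, (∀ k, 0 < ε k) ∧ ∀ δ : ℕ → ℝ, (∀ k, 0 ≤ δ k ∧ δ k ≤ ε k) →
      (∀ x, Summable fun k => δ k * f k x) ∧ ContDiff ℝ ∞ fun x => ∑' k, δ k * f k x := by
  -- Cutoffs equal to 1 on the ball of radius `R + 1`: after multiplication by `χ R` every
  -- derivative is globally bounded, and on that ball nothing changes.
  let χ : ℕ → ContDiffBump (0 : E) := fun R =>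
    ⟨(R : ℝ) + 1, R + 2, by positivity, by linarith⟩
  let F : ℕ → ℕ → E → ℝ := fun R k x => χ R x * f k x
  have hF : ∀ R k, ContDiff ℝ ∞ (F R k) := fun R k => (χ R).contDiff.mul (hf k)
  have hFs : ∀ R k, HasCompactSupport (F R k) := fun R k => (χ R).hasCompactSupport.mul_right
  have hbd : ∀ R k j : ℕ, ∃ C, ∀ x, ‖iteratedFDeriv ℝ j (F R k) x‖ ≤ C := fun R k j =>
    ((hFs R k).iteratedFDeriv j).exists_bound_of_continuous
      ((hF R k).continuous_iteratedFDeriv (by exact_mod_cast le_top))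
  choose C hC using hbd
  have hC0 : ∀ R k j, 0 ≤ C R k j := fun R k j => (norm_nonneg _).trans (hC R k j 0)
  let M : ℕ → ℝ := fun k => ∑ R ∈ Finset.range (k + 1), ∑ j ∈ Finset.range (k + 1), C R k j
  have hM0 : ∀ k, 0 ≤ M k := fun k =>
    Finset.sum_nonneg fun R _ => Finset.sum_nonneg fun j _ => hC0 R k j
  have hCM : ∀ R k j, R ≤ k → j ≤ k → C R k j ≤ M k := fun R k j hR hj =>
    (Finset.single_le_sum (f := fun j => C R k j) (fun j _ => hC0 R k j)
      (Finset.mem_range.2 (Nat.lt_succ_of_le hj))).trans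
    (Finset.single_le_sum (f := fun R => ∑ j ∈ Finset.range (k + 1), C R k j)
      (fun R _ => Finset.sum_nonneg fun j _ => hC0 R k j)
      (Finset.mem_range.2 (Nat.lt_succ_of_le hR)))
  -- Diagonal choice: `M k` dominates the derivatives of order at most `k` of the `k`-th function
  -- cut off at each `R ≤ k`. For fixed `R` and `j` this controls all but finitely many terms by a
  -- geometric series, which is enough.
  refine ⟨fun k => (1 / 2) ^ k / (1 + M k), fun k => by have := hM0 k; positivity, fun δ hδ => ?_⟩
  have hbound : ∀ R k j, R ≤ k → j ≤ k → ∀ x,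
      ‖iteratedFDeriv ℝ j (fun x => δ k * F R k x) x‖ ≤ (1 / 2) ^ k := by
    intro R k j hR hj x
    have h1 : iteratedFDeriv ℝ j (fun x => δ k * F R k x) x =
        δ k • iteratedFDeriv ℝ j (F R k) x :=
      iteratedFDeriv_const_smul_apply (a := δ k)
        ((hF R k).of_le (by exact_mod_cast le_top)).contDiffAt
    rw [h1, norm_smul, Real.norm_of_nonneg (hδ k).1]
    have hM := hM0 k
    calc δ k * ‖iteratedFDeriv ℝ j (F R k) x‖ ≤ (1 / 2) ^ k / (1 + M k) * M k :=
          mul_le_mul (hδ k).2 ((hC R k j x).trans (hCM R k j hR hj)) (norm_nonneg _) (by positivity)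
      _ ≤ (1 / 2) ^ k := by
          rw [div_mul_eq_mul_div, div_le_iff₀ (by positivity)]
          have : (0 : ℝ) < (1 / 2) ^ k := by positivity
          nlinarith
  have hgeo : Summable fun k : ℕ => ((1 / 2 : ℝ)) ^ k :=
    summable_geometric_of_lt_one (by norm_num) (by norm_num)
  have hone : ∀ (R : ℕ) (x : E), ‖x‖ ≤ R + 1 → ∀ k, F R k x = f k x := by
    intro R x hx k
    have : χ R x = 1 := (χ R).one_of_mem_closedBall (by simpa using hx)
    simp [F, this]
  have hsmooth : ∀ R, ContDiff ℝ ∞ fun x => ∑' k, δ k * F R k x := by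
    intro R
    refine contDiff_tsum_of_eventually (v := fun _ k => (1 / 2) ^ k)
      (fun k => contDiff_const.mul (hF R k)) (fun _ _ => hgeo) fun j _ => ?_
    rw [Nat.cofinite_eq_atTop]
    filter_upwards [Filter.eventually_ge_atTop (max R j)] with k hk x
    exact hbound R k j (le_of_max_le_left hk) (le_of_max_le_right hk) x
  refine ⟨fun x => ?_, contDiff_iff_contDiffAt.2 fun x => ?_⟩
  · obtain ⟨R, hR⟩ := exists_nat_ge ‖x‖
    refine hgeo.of_norm_bounded_eventually_nat ?_
    filter_upwards [Filter.eventually_ge_atTop R] with k hk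
    have := hbound R k 0 hk (Nat.zero_le _) x
    rw [norm_iteratedFDeriv_zero, hone R x (by linarith)] at this
    exact this
  · obtain ⟨R, hR⟩ := exists_nat_ge ‖x‖
    refine (hsmooth R).contDiffAt.congr_of_eventuallyEq ?_
    have : {y : E | ‖y‖ < R + 1} ∈ nhds x :=
      (isOpen_lt continuous_norm continuous_const).mem_nhds (by simp; linarith)
    filter_upwards [this] with y hy
    exact tsum_congr fun k => by rw [hone R y (le_of_lt hy)]

/-- If `G` vanishes only where `F` does, then `G` divides `g ∘ F` for some smooth `g` on the line
that vanishes at most at the origin. -/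
theorem exists_comp_eq_mul_of_zeros_subset {E : Type*} [NormedAddCommGroup E] [NormedSpace ℝ E]
    [FiniteDimensional ℝ E] {F G : E → ℝ} (hF : ContDiff ℝ ∞ F) (hG : ContDiff ℝ ∞ G)
    (hFG : ∀ x, G x = 0 → F x = 0) :
    ∃ (g : ℝ → ℝ) (h : E → ℝ), ContDiff ℝ ∞ g ∧ ContDiff ℝ ∞ h ∧ (∀ t, g t = 0 → t = 0) ∧
      ∀ x, g (F x) = G x * h x := by
  -- `β k` vanishes for `k t² ≤ 1` and is positive beyond. A positive combination of all `β k` is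
  -- therefore zero only at the origin, while each `β k` is zero near it.
  let β : ℕ → ℝ → ℝ := fun k t => Real.smoothTransition (k * t ^ 2 - 1)
  have hβ : ∀ k, ContDiff ℝ ∞ (β k) := fun k =>
    Real.smoothTransition.contDiff.comp (by fun_prop)
  have hβ0 : ∀ k, β k 0 = 0 := fun k => Real.smoothTransition.zero_of_nonpos (by norm_num)
  have hf : ∀ k, ContDiff ℝ ∞ fun x => β k (F x) / G x := by
    refine fun k => contDiff_iff_contDiffAt.2 fun x => ?_
    by_cases hx : G x = 0
    -- Near a zero of `G` the function `F` is small, so the numerator vanishes identically there and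
    -- the quotient is locally zero.
    · refine (contDiffAt_const (c := (0 : ℝ))).congr_of_eventuallyEq ?_
      have : {y | (k : ℝ) * F y ^ 2 - 1 < 0} ∈ nhds x :=
        (isOpen_lt (by have := hF.continuous; fun_prop) continuous_const).mem_nhds
          (by simp [hFG x hx])
      filter_upwards [this] with y hy
      rw [show β k (F y) = 0 from Real.smoothTransition.zero_of_nonpos (le_of_lt hy), zero_div]
    · exact ((hβ k).comp hF).contDiffAt.div hG.contDiffAt hx
  obtain ⟨ε₁, hε₁, h₁⟩ := exists_pos_forall_contDiff_tsum _ hf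
  obtain ⟨ε₂, hε₂, h₂⟩ := exists_pos_forall_contDiff_tsum _ hβ
  -- The same weights must serve both series: `∑ δ k * β k` is the function on the line and `∑ δ k *
  -- β k (F) / G` is the cofactor.
  let δ : ℕ → ℝ := fun k => min (ε₁ k) (ε₂ k)
  have hδ : ∀ k, 0 < δ k := fun k => lt_min (hε₁ k) (hε₂ k)
  obtain ⟨-, hs⟩ := h₁ δ fun k => ⟨(hδ k).le, min_le_left _ _⟩
  obtain ⟨hsum, hg⟩ := h₂ δ fun k => ⟨(hδ k).le, min_le_right _ _⟩
  refine ⟨_, _, hg, hs, fun t ht => ?_, fun x => ?_⟩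
  · by_contra h0
    obtain ⟨k, hk⟩ := exists_nat_gt (1 / t ^ 2)
    have ht2 : 0 < t ^ 2 := by positivity
    have hpos : 0 < β k t := Real.smoothTransition.pos_of_pos (by
      rw [div_lt_iff₀ ht2] at hk; linarith)
    have := hsum t |>.tsum_pos
      (fun k => mul_nonneg (hδ k).le (Real.smoothTransition.nonneg _)) k (mul_pos (hδ k) hpos)
    exact this.ne' ht
  · rw [← tsum_mul_left]
    refine tsum_congr fun k => ?_
    by_cases hx : G x = 0
    · rw [hFG x hx, hβ0, hx, mul_zero, zero_mul]
    · field_simp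

/-! ## The `∞`-radical -/

/-- The C^∞-ring of all real functions on a set. -/
def RealFunctions (S : Type u) : Type u := S → ℝ

instance (S : Type u) : CInfRing (RealFunctions S) where
  op f v := fun x => f fun i => v i x
  op_proj _ _ := rfl
  op_comp _ _ _ := rfl

/-- Evaluation of real functions at a point, as a ring homomorphism. -/
def RealFunctions.evalPoint {S : Type u} (x : S) : RealFunctions S →+* ℝ where
  toFun F := F x
  map_zero' := rfl
  map_one' := rfl
  map_add' _ _ := rfl
  map_mul' _ _ := rfl

theorem RealFunctions.add_apply {S : Type u} (F G : RealFunctions S) (x : S) :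
    (F + G) x = F x + G x := rfl

theorem RealFunctions.sub_apply {S : Type u} (F G : RealFunctions S) (x : S) :
    (F - G) x = F x - G x := map_sub (RealFunctions.evalPoint x) F G

theorem RealFunctions.mul_apply {S : Type u} (F G : RealFunctions S) (x : S) :
    (F * G) x = F x * G x := rfl

namespace SmoothFn

theorem add_apply {n : ℕ} (f g : SmoothFn n) (x : Fin n → ℝ) : (f + g) x = f x + g x := rfl

theorem mul_apply {n : ℕ} (f g : SmoothFn n) (x : Fin n → ℝ) : (f * g) x = f x * g x := rfl

theorem one_apply {n : ℕ} (x : Fin n → ℝ) : (1 : SmoothFn n) x = 1 := rfl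

theorem sub_apply {n : ℕ} (f g : SmoothFn n) (x : Fin n → ℝ) : (f - g) x = f x - g x :=
  map_sub (evalPoint x) f g

theorem pow_apply {n : ℕ} (f : SmoothFn n) (k : ℕ) (x : Fin n → ℝ) : (f ^ k) x = f x ^ k :=
  map_pow (evalPoint x) f k

theorem comp_apply {m n : ℕ} (g : SmoothFn m) (f : Fin m → SmoothFn n) (x : Fin n → ℝ) :
    g.comp f x = g fun i => f i x := rfl

theorem proj_apply {n : ℕ} (i : Fin n) (x : Fin n → ℝ) : proj i x = x i := rfl

/-- A smooth function on the line that vanishes at most at the origin. -/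
def VanishesOnlyAtZero (g : SmoothFn 1) : Prop := ∀ t, g t = 0 → t 0 = 0

end SmoothFn

namespace CInfRing

variable {A : Type u} [CInfRing A] {n : ℕ} (v : Fin n → A)

theorem op_add (f g : SmoothFn n) : op (f + g) v = op f v + op g v :=
  (SmoothFn.evalHom v).toRingHom.map_add f g

theorem op_sub (f g : SmoothFn n) : op (f - g) v = op f v - op g v :=
  (SmoothFn.evalHom v).toRingHom.map_sub f g

theorem op_mul (f g : SmoothFn n) : op (f * g) v = op f v * op g v :=
  (SmoothFn.evalHom v).toRingHom.map_mul f g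

theorem op_one : op (1 : SmoothFn n) v = 1 :=
  (SmoothFn.evalHom v).toRingHom.map_one

theorem op_pow (f : SmoothFn n) (k : ℕ) : op (f ^ k) v = op f v ^ k :=
  (SmoothFn.evalHom v).toRingHom.map_pow f k

theorem op_comp_one (g : SmoothFn 1) (f : SmoothFn n) : op (g.comp ![f]) v = op g ![op f v] :=
  (op_vec_one g v f).symm

/-- A nowhere vanishing smooth function takes invertible values. -/
theorem isUnit_op (f : SmoothFn n) (hf : ∀ x, f x ≠ 0) : IsUnit (op f v) := by
  let f' : SmoothFn n := ⟨fun x => (f x)⁻¹, f.smooth.inv hf⟩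
  refine IsUnit.of_mul_eq_one (op f' v) ?_
  rw [← op_mul, ← op_one v]
  congr 1
  ext x
  exact mul_inv_cancel₀ (hf x)

/-- A smooth relation that forces a coordinate to vanish yields a relation for that coordinate
alone. -/
theorem exists_op_mem_of_zeros_subset {I : Ideal A} (F G : SmoothFn n)
    (hFG : ∀ x, G x = 0 → F x = 0) (hG : op G v ∈ I) :
    ∃ g : SmoothFn 1, g.VanishesOnlyAtZero ∧ op g ![op F v] ∈ I := by
  obtain ⟨g, h, hg, hh, hg0, hgh⟩ := exists_comp_eq_mul_of_zeros_subset F.smooth G.smooth hFG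
  refine ⟨⟨fun t => g (t 0), hg.comp (by fun_prop)⟩, fun t ht => hg0 _ ht, ?_⟩
  rw [← op_comp_one]
  have : SmoothFn.comp (⟨fun t => g (t 0), hg.comp (by fun_prop)⟩ : SmoothFn 1) ![F] =
      G * ⟨h, hh⟩ := SmoothFn.ext (funext fun x => hgh x)
  rw [this, op_mul]
  exact I.mul_mem_right _ hG

end CInfRing

theorem CInfHom.map_op_one {A : Type u} {B : Type v} [CInfRing A] [CInfRing B] (φ : CInfHom A B)
    (g : SmoothFn 1) (a : A) : φ (CInfRing.op g ![a]) = CInfRing.op g ![φ a] := by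
  rw [φ.map_op]; congr 1; funext i; fin_cases i; rfl

theorem CInfHom.mem_ker {A : Type u} {B : Type v} [CInfRing A] [CInfRing B] {φ : CInfHom A B}
    {a : A} : a ∈ φ.ker ↔ φ a = 0 := Iff.rfl

theorem CInfQuotient.mk_eq_zero {A : Type u} [CInfRing A] {I : Ideal A} {a : A} :
    CInfQuotient.mk I a = 0 ↔ a ∈ I := by
  have h0 : (0 : CInfQuotient I) = CInfQuotient.mk I 0 :=
    (CInfQuotient.mk I).toRingHom.map_zero.symm
  rw [h0]
  refine (Ideal.Quotient.eq (I := I)).trans ?_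
  rw [sub_zero]

theorem CInfQuotient.mk_eq_mk {A : Type u} [CInfRing A] {I : Ideal A} {a b : A} :
    CInfQuotient.mk I a = CInfQuotient.mk I b ↔ a - b ∈ I :=
  Ideal.Quotient.eq (I := I)

/-! ### Triviality of a localization. -/

namespace CInfLocalization

variable {B : Type u} [CInfRing B] (f : B)

/-- The canonical morphism to the localization. -/
noncomputable def of : CInfHom B (CInfLocalization f) where
  toFun b := CInfPresented.cls _ (.var (some b))
  map_op φ v := by
    rw [CInfPresented.op_cls]
    exact CInfPresented.cls_eq (.of (.op φ v))

/-- The inverse of the inverted element. -/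
def inverse : CInfLocalization f := CInfPresented.cls _ (.var none)

theorem of_mul_inverse : of f f * inverse f = 1 := by
  have h1 : (1 : CInfLocalization f) = of f 1 := (of f).toRingHom.map_one.symm
  rw [h1, CInfRing.mul_def]
  have : ![of f f, inverse f] = fun i => CInfPresented.cls (CInfLocalization.Rel f)
      ((![.var (some f), .var none] : Fin 2 → CInfTerm (Option B)) i) := by
    funext i; fin_cases i <;> rfl
  rw [this, CInfPresented.op_cls]
  exact CInfPresented.cls_eq (.of .inv)

/-- The functions `g(x)` and `x y - 1` have no common zero, so the sum of their squares takes
invertible values; at `(f, f⁻¹)` both vanish, making zero a unit. -/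
theorem subsingleton_of_op_eq_zero {g : SmoothFn 1} (hg : g.VanishesOnlyAtZero)
    (h : CInfRing.op g ![f] = 0) : Subsingleton (CInfLocalization f) := by
  let v : Fin 2 → CInfLocalization f := ![of f f, inverse f]
  let P : SmoothFn 2 := g.comp ![.proj 0] ^ 2 + (.proj 0 * .proj 1 - 1) ^ 2
  have hP : IsUnit (CInfRing.op P v) := by
    refine CInfRing.isUnit_op v P fun x hx => ?_
    have hx' : g ![x 0] ^ 2 + (x 0 * x 1 - 1) ^ 2 = 0 := by
      rw [← hx]
      simp only [P, SmoothFn.add_apply, SmoothFn.pow_apply, SmoothFn.sub_apply, SmoothFn.mul_apply,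
        SmoothFn.one_apply, SmoothFn.comp_apply, SmoothFn.proj_apply]
      congr 3
      funext i; fin_cases i; rfl
    have h1 : g ![x 0] = 0 := by nlinarith [sq_nonneg (g ![x 0]), sq_nonneg (x 0 * x 1 - 1)]
    have h2 : x 0 = 0 := hg _ h1
    rw [h1, h2] at hx'
    norm_num at hx'
  have h0 : CInfRing.op P v = 0 := by
    have hg0 : CInfRing.op g ![of f f] = 0 := by
      rw [← CInfHom.map_op_one, h]
      exact (of f).toRingHom.map_zero
    have hinv : v 0 * v 1 = 1 := of_mul_inverse f
    simp only [P, CInfRing.op_add, CInfRing.op_pow, CInfRing.op_sub, CInfRing.op_mul,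
      CInfRing.op_one, CInfRing.op_comp_one, CInfRing.op_proj, hinv]
    rw [show v 0 = of f f from rfl, hg0]
    ring
  rw [h0, isUnit_zero_iff] at hP
  exact subsingleton_of_zero_eq_one hP

/-- The functions on `ℝ^B` that vanish wherever the coordinate `f` is nonzero and finitely many of
the relations that hold in `B` are satisfied. -/
def eventuallyZero : Ideal (RealFunctions (B → ℝ)) where
  carrier := {F | ∃ (n : ℕ) (e : Fin n → B) (G : SmoothFn n), CInfRing.op G e = 0 ∧
    ∀ x : B → ℝ, G (fun i => x (e i)) = 0 → x f ≠ 0 → F x = 0}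
  zero_mem' := ⟨1, ![0], .proj 0, CInfRing.op_proj _ _, fun _ _ _ => rfl⟩
  add_mem' := by
    rintro F₁ F₂ ⟨n, e, G, hG, h⟩ ⟨m, e', G', hG', h'⟩
    -- The sum of squares encodes two relations in one.
    refine ⟨n + m, Fin.append e e', G.comp (fun i => .proj (Fin.castAdd m i)) ^ 2 +
      G'.comp (fun i => .proj (Fin.natAdd n i)) ^ 2, ?_, fun x hx hf => ?_⟩
    · rw [CInfRing.op_add, CInfRing.op_pow, CInfRing.op_pow, CInfRing.op_comp, CInfRing.op_comp]
      simp only [CInfRing.op_proj, Fin.append_left, Fin.append_right, hG, hG']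
      ring
    · simp only [SmoothFn.add_apply, SmoothFn.pow_apply, SmoothFn.comp_apply, SmoothFn.proj_apply,
        Fin.append_left, Fin.append_right] at hx
      have h1 := sq_nonneg (G fun i => x (e i))
      have h2 := sq_nonneg (G' fun i => x (e' i))
      rw [RealFunctions.add_apply, h x (pow_eq_zero_iff two_ne_zero |>.1 (by linarith)) hf,
        h' x (pow_eq_zero_iff two_ne_zero |>.1 (by linarith)) hf, add_zero]
  smul_mem' := by
    rintro c F ⟨n, e, G, hG, h⟩
    refine ⟨n, e, G, hG, fun x hx hf => ?_⟩
    rw [smul_eq_mul, RealFunctions.mul_apply, h x hx hf, mul_zero]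

/-- The localization acts on germs of functions at the filter of relations of `B`. -/
noncomputable def toGerms : CInfHom (CInfLocalization f) (CInfQuotient (eventuallyZero f)) :=
  CInfPresented.lift
    -- The default value `0⁻¹ = 0` is harmless: points with `x f = 0` are disregarded modulo
    -- `eventuallyZero f`.
    (fun o => CInfQuotient.mk (eventuallyZero f)
      (o.elim (fun x => (x f)⁻¹ : RealFunctions (B → ℝ)) fun b x => x b)) (by
    rintro _ _ (⟨φ, v⟩ | _)
    · rename_i m
      refine Eq.trans ?_ ((CInfQuotient.mk (eventuallyZero f)).map_op φ
        (fun i => (fun x => x (v i) : RealFunctions (B → ℝ))))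
      -- The relation used is `b₀ = φ(b₁, …, bₘ)`, satisfied in `B` by `φ(v)` followed by `v`.
      refine CInfQuotient.mk_eq_mk.2 ⟨m + 1, Fin.cons (CInfRing.op φ v) v,
        .proj 0 - φ.comp (fun i => .proj i.succ), ?_, fun x hx _ => ?_⟩
      · rw [CInfRing.op_sub, CInfRing.op_comp]
        simp only [CInfRing.op_proj, Fin.cons_zero, Fin.cons_succ, sub_self]
      · exact (RealFunctions.sub_apply _ _ x).trans ((SmoothFn.sub_apply _ _ _).symm.trans hx)
    · have h2 : CInfTerm.eval (fun o => CInfQuotient.mk (eventuallyZero f)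
          (o.elim (fun x => (x f)⁻¹ : RealFunctions (B → ℝ)) fun b x => x b))
          (.op SmoothFn.mulFn ![.var (some f), .var none]) =
          CInfQuotient.mk (eventuallyZero f) (fun x => x f * (x f)⁻¹) := by
        refine Eq.trans ?_ ((CInfQuotient.mk (eventuallyZero f)).map_op SmoothFn.mulFn
          ![(fun x => x f : RealFunctions (B → ℝ)), fun x => (x f)⁻¹]).symm
        rw [CInfTerm.eval]
        congr 1; funext i; fin_cases i <;> rfl
      rw [h2]
      refine CInfQuotient.mk_eq_mk.2 ⟨1, ![1], .proj 0 - 1, ?_, fun x hx hf => ?_⟩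
      · rw [CInfRing.op_sub, CInfRing.op_proj, CInfRing.op_one]
        exact sub_self _
      · refine (RealFunctions.sub_apply _ _ x).trans ?_
        simp only [SmoothFn.sub_apply, SmoothFn.proj_apply, SmoothFn.one_apply] at hx
        change x 1 - 1 = 0 at hx
        change x f * (x f)⁻¹ - x 1 = 0
        rw [mul_inv_cancel₀ hf]
        linarith)

/-- If the localization is trivial, then so is the ring of germs it maps to. Hence a single relation
`G` that holds in `B` already forces the coordinate `f` to vanish, and flat division turns it into a
relation in `f` alone. Working on `ℝ^B` avoids any finiteness assumption on `B`. -/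
theorem exists_op_eq_zero_of_subsingleton (h : Subsingleton (CInfLocalization f)) :
    ∃ g : SmoothFn 1, g.VanishesOnlyAtZero ∧ CInfRing.op g ![f] = 0 := by
  have h1 : (1 : RealFunctions (B → ℝ)) ∈ eventuallyZero f := by
    rw [← CInfQuotient.mk_eq_zero]
    refine ((CInfQuotient.mk (eventuallyZero f)).toRingHom.map_one).trans ?_
    rw [← (toGerms f).toRingHom.map_one, ← (toGerms f).toRingHom.map_zero]
    exact congrArg _ (Subsingleton.elim _ _)
  obtain ⟨n, e, G, hG, hf⟩ := h1
  let e' : Fin (n + 1) → B := Fin.cons f e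
  -- The entries of `e'` may repeat. Choosing one index for each value lets every `z` define a
  -- function on `B`, namely `b ↦ z (invFun e' b)`.
  have hinv : ∀ i, e' (Function.invFun e' (e' i)) = e' i := fun i =>
    Function.invFun_eq ⟨i, rfl⟩
  obtain ⟨g, hg, hgf⟩ := CInfRing.exists_op_mem_of_zeros_subset (I := ⊥) e'
    (.proj (Function.invFun e' f)) (G.comp fun i => .proj (Function.invFun e' (e i)))
    (fun z hz => by
      by_contra hne
      exact one_ne_zero (hf (fun b => z (Function.invFun e' b)) hz hne))
    (by
      rw [Ideal.mem_bot, CInfRing.op_comp]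
      simp only [CInfRing.op_proj]
      rw [← hG]
      congr 1
      funext i
      exact hinv i.succ)
  refine ⟨g, hg, ?_⟩
  rwa [Ideal.mem_bot, CInfRing.op_proj, show e' (Function.invFun e' f) = f from hinv 0] at hgf

end CInfLocalization

theorem mem_infRadical_iff {A : Type u} [CInfRing A] {I : Ideal A} {f : A} :
    f ∈ infRadical I ↔ ∃ g : SmoothFn 1, g.VanishesOnlyAtZero ∧ CInfRing.op g ![f] ∈ I := by
  constructor
  · intro h
    obtain ⟨g, hg, h0⟩ := CInfLocalization.exists_op_eq_zero_of_subsingleton _ h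
    exact ⟨g, hg, by rwa [← CInfHom.map_op_one, CInfQuotient.mk_eq_zero] at h0⟩
  · rintro ⟨g, hg, h0⟩
    refine CInfLocalization.subsingleton_of_op_eq_zero _ hg ?_
    rwa [← CInfHom.map_op_one, CInfQuotient.mk_eq_zero]

/-! ## Properties of the two radicals -/

theorem mem_infRadical_of_zeros_subset {A : Type u} [CInfRing A] {I : Ideal A} {n : ℕ}
    {v : Fin n → A} (F G : SmoothFn n) (hFG : ∀ x, G x = 0 → F x = 0)
    (hG : CInfRing.op G v ∈ I) : CInfRing.op F v ∈ infRadical I :=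
  mem_infRadical_iff.2 (CInfRing.exists_op_mem_of_zeros_subset v F G hFG hG)

/-- The `∞`-radical is an ideal. -/
def infRadicalIdeal {A : Type u} [CInfRing A] (I : Ideal A) : Ideal A where
  carrier := infRadical I
  zero_mem' := mem_infRadical_iff.2 ⟨.proj 0, fun _ h => h, by
    rw [CInfRing.op_proj]; exact I.zero_mem⟩
  add_mem' := by
    intro a b ha hb
    obtain ⟨g, hg, hga⟩ := mem_infRadical_iff.1 ha
    obtain ⟨h, hh, hhb⟩ := mem_infRadical_iff.1 hb
    -- `g(x)² + h(y)²` vanishes only at the origin of the plane, where `x + y` vanishes too.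
    have := mem_infRadical_of_zeros_subset (v := ![a, b]) (.proj 0 + .proj 1)
      (g.comp ![.proj 0] ^ 2 + h.comp ![.proj 1] ^ 2) (I := I) (fun x hx => ?_) ?_
    · rw [CInfRing.op_add, CInfRing.op_proj, CInfRing.op_proj] at this
      exact this
    · simp only [SmoothFn.add_apply, SmoothFn.pow_apply, SmoothFn.comp_apply] at hx
      have h1 : x 0 = 0 := hg _ (pow_eq_zero_iff two_ne_zero |>.1
        (le_antisymm (by linarith [sq_nonneg (h fun i => ![SmoothFn.proj 1] i x)])
          (sq_nonneg (g fun i => ![SmoothFn.proj 0] i x))))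
      have h2 : x 1 = 0 := hh _ (pow_eq_zero_iff two_ne_zero |>.1
        (le_antisymm (by linarith [sq_nonneg (g fun i => ![SmoothFn.proj 0] i x)])
          (sq_nonneg (h fun i => ![SmoothFn.proj 1] i x))))
      simp only [SmoothFn.add_apply, SmoothFn.proj_apply, h1, h2, add_zero]
    · rw [CInfRing.op_add, CInfRing.op_pow, CInfRing.op_pow, CInfRing.op_comp_one,
        CInfRing.op_comp_one, CInfRing.op_proj, CInfRing.op_proj]
      exact I.add_mem (I.pow_mem_of_mem hga 2 two_pos) (I.pow_mem_of_mem hhb 2 two_pos)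
  smul_mem' := by
    intro c a ha
    obtain ⟨g, hg, hga⟩ := mem_infRadical_iff.1 ha
    have := mem_infRadical_of_zeros_subset (v := ![c, a]) (.proj 0 * .proj 1)
      (g.comp ![.proj 1]) (I := I) (fun x hx => ?_) ?_
    · rw [CInfRing.op_mul, CInfRing.op_proj, CInfRing.op_proj] at this
      exact this
    · have h1 : x 1 = 0 := hg _ hx
      rw [SmoothFn.mul_apply, SmoothFn.proj_apply, SmoothFn.proj_apply, h1, mul_zero]
    · rw [CInfRing.op_comp_one, CInfRing.op_proj]
      exact hga

namespace NilKind

variable {A B : Type u} [CInfRing A] [CInfRing B] (κ : NilKind)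

/-- The radical as an ideal. -/
def radicalIdeal : NilKind → Ideal A → Ideal A
  | .nilpotent, I => I.radical
  | .infNilpotent, I => infRadicalIdeal I

variable {κ}

theorem radical_eq_radical_iff {I J : Ideal A} :
    κ.radical I = κ.radical J ↔ κ.radicalIdeal I = κ.radicalIdeal J := by
  cases κ
  · exact SetLike.coe_set_eq (A := Ideal A)
  · exact SetLike.coe_set_eq (p := infRadicalIdeal I) (q := infRadicalIdeal J)

theorem mem_radicalIdeal_infNilpotent {I : Ideal A} {f : A} :
    f ∈ infNilpotent.radicalIdeal I ↔
      ∃ g : SmoothFn 1, g.VanishesOnlyAtZero ∧ CInfRing.op g ![f] ∈ I :=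
  mem_infRadical_iff

theorem le_radicalIdeal {I : Ideal A} : I ≤ κ.radicalIdeal I := by
  cases κ
  · exact Ideal.le_radical
  · exact fun f hf => mem_radicalIdeal_infNilpotent.2
      ⟨.proj 0, fun _ h => h, by rwa [CInfRing.op_proj]⟩

theorem radicalIdeal_mono {I J : Ideal A} (h : I ≤ J) : κ.radicalIdeal I ≤ κ.radicalIdeal J := by
  cases κ
  · exact Ideal.radical_mono h
  · intro f hf
    obtain ⟨g, hg, hgf⟩ := mem_radicalIdeal_infNilpotent.1 hf
    exact mem_radicalIdeal_infNilpotent.2 ⟨g, hg, h hgf⟩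

/-- In the `∞` case, if `g` witnesses membership for `I` and `h` for `J`, the product `g * h`
witnesses it for both and still vanishes at most at the origin. -/
theorem radicalIdeal_inf (I J : Ideal A) :
    κ.radicalIdeal (I ⊓ J) = κ.radicalIdeal I ⊓ κ.radicalIdeal J := by
  refine le_antisymm (le_inf (radicalIdeal_mono inf_le_left) (radicalIdeal_mono inf_le_right)) ?_
  cases κ
  · exact (Ideal.radical_inf I J).ge
  · rintro f ⟨hI, hJ⟩
    obtain ⟨g, hg, hgf⟩ := mem_radicalIdeal_infNilpotent.1 hI
    obtain ⟨h, hh, hhf⟩ := mem_radicalIdeal_infNilpotent.1 hJ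
    refine mem_radicalIdeal_infNilpotent.2 ⟨g * h, fun t ht => ?_, ?_, ?_⟩
    · exact (mul_eq_zero.1 ((SmoothFn.mul_apply g h t).symm.trans ht)).elim (hg t) (hh t)
    · rw [SetLike.mem_coe, CInfRing.op_mul]
      exact I.mul_mem_right _ hgf
    · rw [SetLike.mem_coe, CInfRing.op_mul]
      exact J.mul_mem_left _ hhf

/-- In the `∞` case the witnesses compose: `h ∘ g` vanishes only where `g` does. -/
theorem radicalIdeal_radicalIdeal (I : Ideal A) :
    κ.radicalIdeal (κ.radicalIdeal I) = κ.radicalIdeal I := by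
  refine le_antisymm ?_ le_radicalIdeal
  cases κ
  · exact (Ideal.radical_idem I).le
  · intro f hf
    obtain ⟨g, hg, hgf⟩ := mem_radicalIdeal_infNilpotent.1 hf
    obtain ⟨h, hh, hhf⟩ := mem_radicalIdeal_infNilpotent.1 hgf
    refine mem_radicalIdeal_infNilpotent.2 ⟨h.comp ![g], fun t ht => hg t (hh _ ht), ?_⟩
    rwa [CInfRing.op_comp_one]

/-- Both radicals test whether some operation applied to `a` lands in the ideal, and morphisms
commute with operations. This translates conditions on ideals of the source into infinitesimality of
values in the target. -/
theorem mem_radicalIdeal_ker {φ : CInfHom A B} {a : A} :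
    a ∈ κ.radicalIdeal φ.ker ↔ φ a ∈ κ.radicalIdeal (⊥ : Ideal B) := by
  cases κ
  · simp only [radicalIdeal, Ideal.mem_radical_iff, Ideal.mem_bot]
    exact exists_congr fun n => by
      rw [CInfHom.mem_ker, ← show φ.toRingHom (a ^ n) = φ a ^ n from map_pow _ _ _]; rfl
  · simp only [mem_radicalIdeal_infNilpotent, Ideal.mem_bot, CInfHom.mem_ker, CInfHom.map_op_one]

/-- Morphisms preserve infinitesimal elements. -/
theorem map_mem_radicalIdeal (φ : CInfHom A B) {a : A} (h : a ∈ κ.radicalIdeal (⊥ : Ideal A)) :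
    φ a ∈ κ.radicalIdeal (⊥ : Ideal B) :=
  mem_radicalIdeal_ker.1 (radicalIdeal_mono bot_le h)

/-- If `g(j) = 0`, then `(1 + j)²` is the value at `j` of `(1 + x)² + g(x)²`. This function has no
zeros, because `g` vanishes at most at the origin, where the first square is 1. -/
theorem isUnit_one_add {j : B} (h : j ∈ infNilpotent.radicalIdeal (⊥ : Ideal B)) :
    IsUnit (1 + j) := by
  obtain ⟨g, hg, hgj⟩ := mem_radicalIdeal_infNilpotent.1 h
  have hu := CInfRing.isUnit_op ![j] ((1 + .proj 0) ^ 2 + g ^ 2) fun x hx => by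
    simp only [SmoothFn.add_apply, SmoothFn.pow_apply, SmoothFn.one_apply, SmoothFn.proj_apply]
      at hx
    have h0 : x 0 = 0 := hg x (pow_eq_zero_iff two_ne_zero |>.1
      (le_antisymm (by linarith [sq_nonneg (1 + x 0)]) (sq_nonneg (g x))))
    rw [h0] at hx
    linarith [sq_nonneg (g x)]
  rw [CInfRing.op_add, CInfRing.op_pow, CInfRing.op_pow, CInfRing.op_add, CInfRing.op_one,
    CInfRing.op_proj, Ideal.mem_bot.1 hgj, zero_pow two_ne_zero, add_zero] at hu
  exact (isUnit_pow_iff two_ne_zero).1 hu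

/-! ## Sections of a neighbourhood -/

variable {A' : Type u} [CInfRing A'] {φ : CInfHom A A'}

theorem ker_mem_ideals : φ.ker ∈ κ.ideals φ := rfl

theorem inf_mem_ideals {I J : Ideal A} (hI : I ∈ κ.ideals φ) (hJ : J ∈ κ.ideals φ) :
    I ⊓ J ∈ κ.ideals φ := by
  have hI' := radical_eq_radical_iff.1 hI
  have hJ' := radical_eq_radical_iff.1 hJ
  refine radical_eq_radical_iff.2 ?_
  rw [radicalIdeal_inf, hI', hJ', inf_idem]

/-- The cosets of the images of the ideals in `κ.ideals φ` form a basis of the topology. -/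
theorem exists_ideal_of_isOpen {U : Set (CInfQuotient (κ.vanishing φ))}
    (hU : @IsOpen _ (κ.topology φ) U) {a : A} (ha : CInfQuotient.mk (κ.vanishing φ) a ∈ U) :
    ∃ I ∈ κ.ideals φ, CInfQuotient.mk (κ.vanishing φ) '' {x | x - a ∈ I} ⊆ U := by
  induction hU with
  | basic U hU =>
    obtain ⟨I, hI, b, rfl⟩ := hU
    obtain ⟨x, hx, hxa⟩ := ha
    refine ⟨I, hI, ?_⟩
    rintro _ ⟨y, hy, rfl⟩
    -- The coset of `a` is translated to a representative `x` that lies in the coset of `b`; `x` and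
    -- `a` agree in the quotient.
    refine ⟨x + (y - a), ?_, CInfQuotient.mk_eq_mk.2 ?_⟩
    · have : x + (y - a) - b = (x - b) + (y - a) := by ring
      rw [Set.mem_ofPred_eq, this]
      exact I.add_mem hx hy
    · have : x + (y - a) - y = x - a := by ring
      rw [this]
      exact CInfQuotient.mk_eq_mk.1 hxa
  | univ => exact ⟨_, ker_mem_ideals, Set.subset_univ _⟩
  | inter U V _ _ ihU ihV =>
    obtain ⟨I, hI, hIU⟩ := ihU ha.1
    obtain ⟨J, hJ, hJV⟩ := ihV ha.2
    exact ⟨I ⊓ J, inf_mem_ideals hI hJ, Set.subset_inter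
      ((Set.image_mono fun x hx => hx.1).trans hIU) ((Set.image_mono fun x hx => hx.2).trans hJV)⟩
  | sUnion S _ ih =>
    obtain ⟨U, hU, haU⟩ := ha
    obtain ⟨I, hI, hIU⟩ := ih U hU haU
    exact ⟨I, hI, hIU.trans (Set.subset_sUnion_of_mem hU)⟩

/-- If `ψ` takes infinitesimal values on `φ.ker`, then `ψ.ker` contains one of the ideals in
`κ.ideals φ`. -/
theorem inf_ker_mem_ideals {ψ : CInfHom A B} (h : φ.ker ≤ κ.radicalIdeal ψ.ker) :
    ψ.ker ⊓ φ.ker ∈ κ.ideals φ := by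
  refine radical_eq_radical_iff.2 ?_
  rw [radicalIdeal_inf, inf_eq_right]
  exact (radicalIdeal_mono h).trans (radicalIdeal_radicalIdeal _).le

/-- For jets, `ψ.ker ⊓ φ.ker` is one of the ideals being intersected. For germs, let `a b = 0` with
`φ b` invertible: lifting the inverse to `c`, the element `b c - 1` vanishes on `X'`, so its image
under `ψ` is infinitesimal, `ψ b` is a unit, and `ψ a = 0`. -/
theorem vanishing_le_ker (hφ : Function.Surjective φ) {ψ : CInfHom A B}
    (h : φ.ker ≤ κ.radicalIdeal ψ.ker) : κ.vanishing φ ≤ ψ.ker := by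
  cases κ
  · exact (sInf_le (inf_ker_mem_ideals h)).trans inf_le_left
  · rintro a ⟨b, hab, hb⟩
    obtain ⟨c', hc'⟩ := hb.exists_right_inv
    obtain ⟨c, rfl⟩ := hφ c'
    have hker : b * c - 1 ∈ φ.ker := by
      refine (φ.toRingHom.map_sub _ _).trans ?_
      rw [map_mul, map_one]
      exact sub_eq_zero.2 hc'
    have hu := isUnit_one_add (mem_radicalIdeal_ker.1 (h hker))
    have h1 : 1 + ψ (b * c - 1) = ψ b * ψ c := by
      have : ψ (b * c - 1) = ψ b * ψ c - 1 := by
        refine (ψ.toRingHom.map_sub _ _).trans ?_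
        rw [map_mul, map_one]
        rfl
      rw [this]; ring
    rw [h1] at hu
    have h0 : ψ a * ψ b = 0 :=
      (ψ.toRingHom.map_mul a b).symm.trans ((congrArg ψ.toRingHom hab).trans ψ.toRingHom.map_zero)
    exact ((isUnit_of_mul_isUnit_left hu).mul_left_eq_zero).1 h0

end NilKind

/-- The morphism from a quotient induced by a morphism that kills the ideal. -/
noncomputable def CInfQuotient.lift {A : Type u} {B : Type v} [CInfRing A] [CInfRing B]
    {I : Ideal A} (ψ : CInfHom A B) (h : I ≤ ψ.ker) : CInfHom (CInfQuotient I) B where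
  toFun := Ideal.Quotient.lift I ψ.toRingHom h
  map_op f q := by
    obtain ⟨a, rfl⟩ : ∃ a : _ → A, q = fun i => CInfQuotient.mk I (a i) :=
      ⟨fun i => (CInfQuotient.cls_surjective I (q i)).choose,
        funext fun i => (CInfQuotient.cls_surjective I (q i)).choose_spec.symm⟩
    rw [← (CInfQuotient.mk I).map_op]
    exact ψ.map_op f a

namespace NilKind

/-- A point of `X` lies in the neighbourhood of `X'` if and only if the functions vanishing on `X'`
are infinitesimal at it. -/
theorem mem_range_nbhdι_iff (κ : NilKind) {X' X : CInfScheme.{u}} {Φ : X' ⟶ X}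
    (hΦ : Function.Surjective (CInfScheme.pullback Φ)) {T : CInfScheme.{u}ᵒᵖ} (ψ : T.unop ⟶ X) :
    ψ ∈ Set.range ((κ.nbhdι Φ).app T) ↔
      (CInfScheme.pullback Φ).ker ≤ κ.radicalIdeal (CInfScheme.pullback ψ).ker := by
  constructor
  · rintro ⟨⟨χ, hχ⟩, rfl⟩
    -- The target is discrete, so the kernel is open and contains the image of one of the defining
    -- ideals, whose radical is that of the ideal of `X'`.
    have hopen : @IsOpen _ (κ.topology (CInfScheme.pullback Φ)) (χ ⁻¹' {0}) :=
      @Continuous.isOpen_preimage _ _ (κ.topology (CInfScheme.pullback Φ)) ⊥ χ.toFun hχ {0}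
        (@isOpen_discrete _ ⊥ (@DiscreteTopology.mk _ ⊥ rfl) _)
    obtain ⟨I, hI, hIU⟩ := exists_ideal_of_isOpen hopen (a := (0 : X.unop))
      (((CInfHom.comp χ (CInfQuotient.mk _)).toRingHom).map_zero)
    have hle : I ≤ (CInfHom.comp χ (CInfQuotient.mk
        (κ.vanishing (CInfScheme.pullback Φ)))).ker := fun x hx =>
      hIU ⟨x, by rwa [Set.mem_ofPred_eq, sub_zero], rfl⟩
    exact (le_radicalIdeal.trans (radical_eq_radical_iff.1 hI).ge).trans (radicalIdeal_mono hle)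
  · intro h
    have hle := vanishing_le_ker hΦ h
    refine ⟨⟨CInfQuotient.lift (CInfScheme.pullback ψ) hle, ?_⟩, rfl⟩
    refine @Continuous.mk _ _ (κ.topology (CInfScheme.pullback Φ)) ⊥ _ fun s _ => ?_
    refine (@isOpen_iff_forall_mem_open _ (κ.topology (CInfScheme.pullback Φ)) _).2 fun q hq => ?_
    obtain ⟨a, rfl⟩ := CInfQuotient.cls_surjective _ q
    -- The morphism is constant on cosets of `ψ.ker ⊓ Φ.ker`, and these are basic open sets.
    refine ⟨CInfQuotient.mk _ '' {x | x - a ∈ (CInfScheme.pullback ψ).ker ⊓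
      (CInfScheme.pullback Φ).ker}, ?_, .basic _ ⟨_, inf_ker_mem_ideals h, a, rfl⟩,
      a, by rw [Set.mem_ofPred_eq, sub_self]; exact Ideal.zero_mem _, rfl⟩
    rintro _ ⟨x, hx, rfl⟩
    have hxa : CInfScheme.pullback ψ x = CInfScheme.pullback ψ a :=
      sub_eq_zero.1 (((CInfScheme.pullback ψ).toRingHom.map_sub x a).symm.trans hx.1)
    rw [Set.mem_preimage] at hq ⊢
    have : CInfQuotient.lift (CInfScheme.pullback ψ) hle (CInfQuotient.mk _ x) =
        CInfQuotient.lift (CInfScheme.pullback ψ) hle (CInfQuotient.mk _ a) := hxa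
    exact this ▸ hq

end NilKind

/-! ## Infinitesimally close points -/

namespace CInfScheme

variable {T X : CInfScheme.{u}}

/-- Two points are infinitesimally close if every function takes infinitesimally close values
at them. -/
def InfClose (κ : NilKind) (x y : T ⟶ X) : Prop :=
  ∀ a, pullback x a - pullback y a ∈ κ.radicalIdeal (⊥ : Ideal T.unop)

variable {κ : NilKind}

theorem InfClose.refl (x : T ⟶ X) : InfClose κ x x := fun a => by
  rw [sub_self]; exact Ideal.zero_mem _

theorem InfClose.symm {x y : T ⟶ X} (h : InfClose κ x y) : InfClose κ y x := fun a => by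
  rw [← neg_sub]; exact neg_mem (h a)

theorem InfClose.trans {x y z : T ⟶ X} (h : InfClose κ x y) (h' : InfClose κ y z) :
    InfClose κ x z := fun a => by
  rw [← sub_add_sub_cancel _ (pullback y a)]; exact add_mem (h a) (h' a)

theorem InfClose.comp {S : CInfScheme.{u}} {x y : T ⟶ X} (h : InfClose κ x y) (f : S ⟶ T) :
    InfClose κ (f ≫ x) (f ≫ y) := fun a => by
  have := κ.map_mem_radicalIdeal (pullback f) (h a)
  rwa [show pullback f (pullback x a - pullback y a) = pullback f (pullback x a) -
    pullback f (pullback y a) from (pullback f).toRingHom.map_sub _ _] at this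

theorem pullback_diagonal_surjective (X : CInfScheme.{u}) (n : SimplexCategoryᵒᵖ) :
    Function.Surjective (pullback (X.diagonal n)) := fun a =>
  ⟨pullback (X.powerπ n 0) a,
    congrFun (congrArg (fun f : X ⟶ X => (pullback f).toFun) (tuple_π n (fun _ => 𝟙 X) 0)) a⟩

/-- The kernel of the diagonal lies in every ideal that contains the differences of the
coordinates. -/
theorem ker_diagonal_le {n : SimplexCategoryᵒᵖ} {J : Ideal (X.powers.obj n).unop}
    (h : ∀ i a, pullback (X.powerπ n i) a - pullback (X.powerπ n 0) a ∈ J) :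
    (pullback (X.diagonal n)).ker ≤ J := by
  -- On the closed subscheme cut out by `J` all coordinates agree, so its inclusion `q` factors
  -- through the diagonal by the universal property of the product. Functions vanishing on the
  -- diagonal thus vanish modulo `J`.
  let q : op (⟨CInfQuotient J⟩ : CInfRingCat.{u}) ⟶ X.powers.obj n :=
    (CInfRingCat.ofHom (B := ⟨CInfQuotient J⟩) (CInfQuotient.mk J)).op
  have hq : ∀ i, q ≫ X.powerπ n i = q ≫ X.powerπ n 0 := fun i =>
    Quiver.Hom.unop_inj (CInfHom.ext (funext fun a => CInfQuotient.mk_eq_mk.2 (h i a)))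
  have hfac : (q ≫ X.powerπ n 0) ≫ X.diagonal n = q := by
    refine powers_hom_ext fun i => ?_
    rw [Category.assoc, diagonal, tuple_π, Category.comp_id]
    exact (hq i).symm
  intro b hb
  refine CInfQuotient.mk_eq_zero.1 ?_
  have hb' : CInfQuotient.mk J b =
      pullback (q ≫ X.powerπ n 0) (pullback (X.diagonal n) b) :=
    (congrFun (congrArg (fun f : _ ⟶ X.powers.obj n => (pullback f).toFun) hfac) b).symm
  rw [hb', CInfHom.mem_ker.1 hb]
  exact (pullback (q ≫ X.powerπ n 0)).toRingHom.map_zero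

/-- A point of `X^{k+1}` lies in the neighbourhood of the main diagonal if and only if its
coordinates are infinitesimally close to each other. -/
theorem mem_range_diagNbhdι_iff (κ : NilKind) {T : CInfScheme.{u}ᵒᵖ} {n : SimplexCategoryᵒᵖ}
    (ψ : T.unop ⟶ X.powers.obj n) :
    ψ ∈ Set.range ((κ.diagNbhdι X n).app T) ↔
      ∀ i j, InfClose κ (ψ ≫ X.powerπ n i) (ψ ≫ X.powerπ n j) := by
  refine (κ.mem_range_nbhdι_iff (pullback_diagonal_surjective X n) ψ).trans ⟨fun h i j a => ?_,
    fun h => ker_diagonal_le fun i a => NilKind.mem_radicalIdeal_ker.2 ?_⟩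
  -- All projections restrict to the identity along the diagonal, so differences of coordinate
  -- functions lie in its ideal.
  · have hmem : pullback (X.powerπ n i) a - pullback (X.powerπ n j) a ∈
        (pullback (X.diagonal n)).ker := by
      have hi : ∀ i, pullback (X.diagonal n) (pullback (X.powerπ n i) a) = a := fun i =>
        congrFun (congrArg (fun f : X ⟶ X => (pullback f).toFun) (tuple_π n (fun _ => 𝟙 X) i)) a
      refine ((pullback (X.diagonal n)).toRingHom.map_sub _ _).trans ?_
      exact (congrArg₂ (· - ·) (hi i) (hi j)).trans (sub_self a)
    have := NilKind.mem_radicalIdeal_ker.1 (h hmem)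
    rwa [show pullback ψ (_ - _) = _ from (pullback ψ).toRingHom.map_sub _ _] at this
  · rw [show pullback ψ (_ - _) = _ from (pullback ψ).toRingHom.map_sub _ _]
    exact h i 0 a

theorem tuple_mem_range_diagNbhdι_iff (κ : NilKind) {T : CInfScheme.{u}ᵒᵖ}
    {n : SimplexCategoryᵒᵖ} (x : Fin (n.unop.len + 1) → (T.unop ⟶ X)) :
    tuple n x ∈ Set.range ((κ.diagNbhdι X n).app T) ↔ ∀ i j, InfClose κ (x i) (x j) := by
  rw [mem_range_diagNbhdι_iff]
  simp only [tuple_π]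

/-- The sub-groupoid of pairs of infinitesimally close points. -/
def infCloseGroupoid (κ : NilKind) (X : CInfScheme.{u}) :
    SubgroupoidPresheaf X.pairGroupoid where
  obj T :=
    { arrows := fun x y => {_p | InfClose κ (T := T.unop) (X := X) (Codiscrete.as x)
        (Codiscrete.as y)}
      inv := fun h => h.symm
      mul := fun h _ h' => h.trans h' }
  map_mem f _ _ _ h := InfClose.comp h f.unop

end CInfScheme

/-! ## Lifting morphisms along monomorphisms of presheaves -/

section Lifting

variable {C : Type u} [Category.{v} C]

/-- Lifts through an injection are unique, so those chosen objectwise are automatically natural. -/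
theorem exists_lift_of_forall_mem_range {P N Z : C ⥤ Type w} (η : P ⟶ Z) (ι : N ⟶ Z)
    (hι : ∀ T, Function.Injective (ι.app T))
    (h : ∀ T p, η.app T p ∈ Set.range (ι.app T)) : ∃ g : P ⟶ N, g ≫ ι = η := by
  choose g hg using h
  refine ⟨{ app := fun T => ↾(g T), naturality := fun S T f => ?_ }, ?_⟩
  · ext p
    refine hι T ?_
    refine (hg T (P.map f p)).trans ?_
    rw [NatTrans.naturality_apply, ← hg S p, ← NatTrans.naturality_apply]
    rfl
  · ext T p
    exact hg T p

theorem exists_lift_of_forall_mem_range_app {D : Type*} [Category* D] {P N Z : D ⥤ C ⥤ Type w}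
    (η : P ⟶ Z) (ι : N ⟶ Z) (hι : ∀ n T, Function.Injective ((ι.app n).app T))
    (h : ∀ n T p, (η.app n).app T p ∈ Set.range ((ι.app n).app T)) :
    ∃ g : P ⟶ N, g ≫ ι = η := by
  choose g hg using fun n => exists_lift_of_forall_mem_range (η.app n) (ι.app n) (hι n) (h n)
  have hmono : ∀ n, Mono (ι.app n) := fun n =>
    have : ∀ T, Mono ((ι.app n).app T) := fun T => (mono_iff_injective _).2 (hι n T)
    NatTrans.mono_of_mono_app _
  refine ⟨{ app := g, naturality := fun m n θ => ?_ }, ?_⟩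
  · have := hmono n
    rw [← cancel_mono (ι.app n), Category.assoc, hg, Category.assoc, ι.naturality,
      ← Category.assoc, hg, η.naturality]
  · ext1
    funext n
    exact hg n

/-- Sub-presheaves with the same sections are isomorphic. -/
theorem exists_iso_of_range_eq {D : Type*} [Category* D] {P N Z : D ⥤ C ⥤ Type w}
    (η : P ⟶ Z) (ι : N ⟶ Z) (hη : ∀ n T, Function.Injective ((η.app n).app T))
    (hι : ∀ n T, Function.Injective ((ι.app n).app T))
    (h : ∀ n T, Set.range ((η.app n).app T) = Set.range ((ι.app n).app T)) :
    ∃ φ : P ≅ N, φ.hom ≫ ι = η := by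
  have hmono : ∀ {P : D ⥤ C ⥤ Type w} (η : P ⟶ Z),
      (∀ n T, Function.Injective ((η.app n).app T)) → Mono η := fun η hη =>
    have : ∀ n, Mono (η.app n) := fun n =>
      have : ∀ T, Mono ((η.app n).app T) := fun T => (mono_iff_injective _).2 (hη n T)
      NatTrans.mono_of_mono_app _
    NatTrans.mono_of_mono_app _
  have := hmono η hη
  have := hmono ι hι
  obtain ⟨f, hf⟩ := exists_lift_of_forall_mem_range_app η ι hι fun n T p => h n T ▸ ⟨p, rfl⟩
  obtain ⟨g, hg⟩ := exists_lift_of_forall_mem_range_app ι η hη fun n T p =>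
    (h n T).symm ▸ ⟨p, rfl⟩
  exact ⟨⟨f, g, by rw [← cancel_mono η, Category.assoc, hg, hf, Category.id_comp],
    by rw [← cancel_mono ι, Category.assoc, hf, hg, Category.id_comp]⟩, hf⟩

end Lifting

/-! ### The nerve of the groupoid of close points. -/

namespace CInfScheme

variable {X : CInfScheme.{u}}

theorem diagNbhdι_app_injective (κ : NilKind) (n : SimplexCategoryᵒᵖ) (T : CInfScheme.{u}ᵒᵖ) :
    Function.Injective ((κ.diagNbhdι X n).app T) :=
  (mono_iff_injective _).1 inferInstance

/-- The simplicial structure morphisms of `X^•` restrict to the neighbourhoods of the diagonals. -/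
theorem restricts (κ : NilKind) (X : CInfScheme.{u}) : κ.Restricts X := by
  intro m n θ
  refine exists_lift_of_forall_mem_range _ _ (diagNbhdι_app_injective κ n) fun T p => ?_
  have hp := (mem_range_diagNbhdι_iff κ ((κ.diagNbhdι X m).app T p)).1 ⟨p, rfl⟩
  refine (mem_range_diagNbhdι_iff κ (((κ.diagNbhdι X m).app T p) ≫ X.powers.map θ)).2
    fun i j => ?_
  -- Each coordinate of the image is a coordinate of the original point, so pairwise closeness is
  -- inherited.
  rw [Category.assoc, Category.assoc, powers_map_π, powers_map_π]
  exact hp _ _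

/-- The vertices of a simplex of the nerve of the groupoid of infinitesimally close points are close
to each other. -/
theorem infClose_of_functor {κ : NilKind} {T : CInfScheme.{u}ᵒᵖ} {n : ℕ}
    (F : ComposableArrows ((infCloseGroupoid κ X).obj T).objs n) (i j : Fin (n + 1)) :
    InfClose κ (T := T.unop) (X := X) (Codiscrete.as (F.obj i).1)
      (Codiscrete.as (F.obj j).1) := by
  rcases le_total i j with h | h
  · exact (F.map (homOfLE h)).2
  · exact InfClose.symm (F.map (homOfLE h)).2

/-- The inclusion of the nerve of the groupoid of infinitesimally close points into `X^•`. -/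
noncomputable def infCloseNerveι (κ : NilKind) (X : CInfScheme.{u}) :
    nervePresheaf.obj (infCloseGroupoid κ X).toGrpd ⟶ X.powersPresheaf :=
  nervePresheaf.map (infCloseGroupoid κ X).incl ≫ X.pairNerveIso.hom

theorem infCloseNerveι_app_injective (κ : NilKind) (n : SimplexCategoryᵒᵖ)
    (T : CInfScheme.{u}ᵒᵖ) : Function.Injective (((infCloseNerveι κ X).app n).app T) := by
  have h1 : Function.Injective ((X.pairNerveIso.hom.app n).app T) :=
    (mono_iff_injective _).1 inferInstance
  have h2 : Function.Injective (((nervePresheaf.map (infCloseGroupoid κ X).incl).app n).app T) :=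
    fun F G h => Subgroupoid.functor_ext h
  exact h1.comp h2

/-- Arrows of the pair groupoid are determined by their endpoints, so a simplex is its tuple of
vertices, and it lies in the sub-groupoid exactly when they are pairwise close. This is also the
criterion for the neighbourhood of the diagonal. -/
theorem range_infCloseNerveι_app (κ : NilKind) (n : SimplexCategoryᵒᵖ) (T : CInfScheme.{u}ᵒᵖ) :
    Set.range (((infCloseNerveι κ X).app n).app T) = Set.range ((κ.diagNbhdι X n).app T) := by
  ext ψ
  constructor
  · rintro ⟨F, rfl⟩
    exact (tuple_mem_range_diagNbhdι_iff κ _).2 (infClose_of_functor F)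
  · intro hψ
    have h := (mem_range_diagNbhdι_iff κ ψ).1 hψ
    let F : ComposableArrows ((infCloseGroupoid κ X).obj T).objs n.unop.len :=
      { obj := fun i => ⟨Codiscrete.mk (ψ ≫ X.powerπ n i), (), InfClose.refl _⟩
        map := fun {i j} _ => ⟨(), h i j⟩ }
    exact ⟨F, powers_hom_ext fun i => tuple_π n _ i⟩

end CInfScheme

/-- For every C^∞-scheme `X` and for both notions of nilpotence, the neighbourhood of the diagonal
in `X × X` is the presheaf of arrows of a sub-groupoid (with the same objects) of the pair groupoid
of `X`; the neighbourhoods of the main diagonals form a simplicial sub-presheaf of `X^•`, and this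
is the nerve of the sub-groupoid, compatibly with the identification of the nerve of the pair
groupoid with `X^•`. -/
theorem mainTheorem5 (X : CInfScheme.{u}) (κ : NilKind) :
    Mono (κ.diagNbhdι X (op (SimplexCategory.mk 1))) ∧
    ∃ H : SubgroupoidPresheaf X.pairGroupoid,
      (∀ T : CInfScheme.{u}ᵒᵖ, (H.obj T).IsWide) ∧
      (∀ (T : CInfScheme.{u}ᵒᵖ) (x y : T.unop ⟶ X)
        (p : (Codiscrete.mk x : Codiscrete (T.unop ⟶ X)) ⟶ Codiscrete.mk y),
        p ∈ (H.obj T).arrows (Codiscrete.mk x) (Codiscrete.mk y) ↔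
          CInfScheme.tuple (op (SimplexCategory.mk 1)) ![x, y] ∈
            Set.range ((κ.diagNbhdι X (op (SimplexCategory.mk 1))).app T)) ∧
      ∃ (hN : κ.Restricts X)
        (φ : nervePresheaf.obj H.toGrpd ≅ κ.diagNbhdSimplicial X hN),
        φ.hom ≫ κ.diagNbhdSimplicialι X hN =
          nervePresheaf.map H.incl ≫ X.pairNerveIso.hom := by
  refine ⟨inferInstance, CInfScheme.infCloseGroupoid κ X, fun T => ⟨fun x => ?_⟩,
    fun T x y p => ?_, CInfScheme.restricts κ X, ?_⟩
  · exact CInfScheme.InfClose.refl _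
  · refine Iff.trans ?_ (CInfScheme.tuple_mem_range_diagNbhdι_iff κ _).symm
    refine ⟨fun h i j => ?_, fun h => h 0 1⟩
    -- For a pair, pairwise closeness amounts to one condition, by reflexivity and symmetry.
    have h' : CInfScheme.InfClose κ x y := h
    fin_cases i <;> fin_cases j
    exacts [.refl _, h', h'.symm, .refl _]
  · exact exists_iso_of_range_eq (CInfScheme.infCloseNerveι κ X)
      (κ.diagNbhdSimplicialι X (CInfScheme.restricts κ X))
      (CInfScheme.infCloseNerveι_app_injective κ)
      (CInfScheme.diagNbhdι_app_injective κ) (CInfScheme.range_infCloseNerveι_app κ)
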